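/- For integers $n,k\ge 2$ let $\Gamma_{n,k}=P_n\rhd P_k$ be the comb graph obtained by grafting a copy of the path $P_k$ on $k$ vertices, by one of its endpoints, onto each vertex of the path $P_n$ on $n$ vertices (the backbone). Let $H_{n,k}=\Gamma_{n,k}+P_\infty$ be the graph obtained from the disjoint union of $\Gamma_{n,k}$ and the one-sided infinite path $P_\infty$ by adding one edge that joins the endpoint of $P_\infty$ to an end vertex of the backbone $P_n$. The spectrum $\sigma(H_{n,k})\subset\mathbb{C}$ is the spectrum of the adjacency operator $(Af)(v)=\sum_{w\sim v}f(w)$, a bounded self-adjoint operator on the complex space $\ell^2$ of the vertex set; the discrete spectrum $\sigma_d(H_{n,k})$ is the set of isolated points of the spectrum that are eigenvalues of finite multiplicity, the multiplicity being the dimension of the eigenspace. Put $\sigma_d^+(H_{n,k})=\sigma_d(H_{n,k})\cap(2,\infty)$. (i) For all $n,k\ge2$, $\sigma(H_{n,k})=[-2,2]\cup\sigma_d(H_{n,k})$, the union is disjoint, and $\sigma_d(H_{n,k})$ is finite and symmetric with respect to the origin. (ii) For all $n,k\ge2$, the number of (distinct) points of $\sigma_d^+(H_{n,k})$ is $$\bigl|\sigma_d^+(H_{n,k})\bigr|=\Bigl[\frac{\omega_k}{\pi}(n+1)\Bigr]+\chi(a_{n,k}-1),\qquad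 \omega_k=\arccos\frac{k+1}{2k},\quad a_{n,k}=\frac{\sin n\omega_k}{\sin (n+1)\omega_k},$$ where $\sin(n+1)\omega_k\ne0$, $[x]$ is the integer part of $x$, and $\chi$ is the Heaviside function, $\chi(x)=1$ for $x>0$ and $\chi(x)=0$ for $x\le0$. (iii) $\sigma_d^+(H_{n,k})\subset[2,\frac52]$ for all $n,k\ge2$, and $\sigma_d^+(H_{n,2})\subset[2,1+\sqrt2]$ for all $n\ge2$. Both intervals are the smallest with this property: if a closed interval $[a,b]$ contains $\sigma_d^+(H_{n,k})$ for all $n,k\ge2$, then $[2,\frac52]\subset[a,b]$; if $[a,b]$ contains $\sigma_d^+(H_{n,2})$ for all $n\ge2$, then $[2,1+\sqrt2]\subset[a,b]$. (iv) For all $n,k\ge2$, each $\nu\in\sigma_d(H_{n,k})$ has multiplicity at most $2$, and at most $4$ points of $\sigma_d(H_{n,k})$ have multiplicity $2$. -/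

import Mathlib

open scoped ENNReal

noncomputable section

namespace CombTail

/-! ### Graphs -/

/-- The comb product `G ▷ H` of a backbone `G` and a finger `H` with contact vertex `o` of `H`:
a copy of `H` is grafted by its vertex `o` to each vertex of `G`. -/
def combProduct {V W : Type*} (G : SimpleGraph V) (H : SimpleGraph W) (o : W) :
    SimpleGraph (V × W) where
  Adj p q := (G.Adj p.1 q.1 ∧ p.2 = o ∧ q.2 = o) ∨ (p.1 = q.1 ∧ H.Adj p.2 q.2)
  symm := ⟨by
    rintro p q (⟨h, h1, h2⟩ | ⟨h, h1⟩)
    · exact Or.inl ⟨h.symm, h2, h1⟩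
    · exact Or.inr ⟨h.symm, h1.symm⟩⟩
  loopless := ⟨by
    rintro p (⟨h, -, -⟩ | ⟨-, h⟩)
    · exact G.irrefl h
    · exact H.irrefl h⟩

/-- The coupling `G + H` of two disjoint graphs by means of the bridge `{v, w}`. -/
def coupling {V W : Type*} (G : SimpleGraph V) (H : SimpleGraph W) (v : V) (w : W) :
    SimpleGraph (V ⊕ W) :=
  (G ⊕g H) ⊔ SimpleGraph.edge (Sum.inl v) (Sum.inr w)

/-- The one-sided infinite path, with vertices `0, 1, 2, …`. -/
def infPath : SimpleGraph ℕ := SimpleGraph.hasse ℕ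

/-- The comb graph `P_n ▷ P_k`; the contact vertex is an endpoint of `P_k`. -/
def combGraph (n k : ℕ) (hk : 2 ≤ k) : SimpleGraph (Fin n × Fin k) :=
  combProduct (SimpleGraph.pathGraph n) (SimpleGraph.pathGraph k) ⟨0, by omega⟩

/-- The comb graph with tail `H_{n,k} = (P_n ▷ P_k) + P_∞`: the endpoint of the infinite path is
joined to the last vertex of the backbone `P_n`. -/
def combTail (n k : ℕ) (hn : 2 ≤ n) (hk : 2 ≤ k) : SimpleGraph ((Fin n × Fin k) ⊕ ℕ) :=
  coupling (combGraph n k hk) infPath (⟨n - 1, by omega⟩, ⟨0, by omega⟩) 0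

/-! ### The adjacency operator of a uniformly locally finite graph -/

/-- The degrees of the vertices are finite and bounded. -/
def UniformlyLocallyFinite {V : Type*} (G : SimpleGraph V) : Prop :=
  ∃ D : ℕ, ∀ v, (G.neighborSet v).encard ≤ D

theorem UniformlyLocallyFinite.finite {V : Type*} {G : SimpleGraph V}
    (h : UniformlyLocallyFinite G) (v : V) : (G.neighborSet v).Finite := by
  obtain ⟨D, hD⟩ := h
  exact Set.finite_of_encard_le_coe (hD v)

/-- The finite set of neighbours of a vertex. -/
def nbrs {V : Type*} {G : SimpleGraph V} (h : UniformlyLocallyFinite G) (v : V) : Finset V :=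
  (h.finite v).toFinset

theorem mem_nbrs {V : Type*} {G : SimpleGraph V} (h : UniformlyLocallyFinite G) {v w : V} :
    w ∈ nbrs h v ↔ G.Adj v w := by
  simp [nbrs]

theorem exists_card_nbrs_le {V : Type*} {G : SimpleGraph V} (h : UniformlyLocallyFinite G) :
    ∃ D : ℕ, ∀ v, (nbrs h v).card ≤ D := by
  obtain ⟨D, hD⟩ := id h
  refine ⟨D, fun v => ?_⟩
  have := hD v
  rw [(h.finite v).encard_eq_coe_toFinset_card] at this
  exact_mod_cast this

/-- The complex Hilbert space `ℓ²(V)`. -/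
abbrev ell2 (V : Type*) : Type _ := lp (fun _ : V => ℂ) 2

theorem sum_nbrs_sq_le {V : Type*} {G : SimpleGraph V} (h : UniformlyLocallyFinite G) {D : ℕ}
    (hD : ∀ v, (nbrs h v).card ≤ D) (f : ell2 V) (s : Finset V) :
    ∑ v ∈ s, ‖∑ w ∈ nbrs h v, f w‖ ^ (2 : ℝ≥0∞).toReal
      ≤ ((D : ℝ) * ‖f‖) ^ (2 : ℝ≥0∞).toReal := by
  classical
  have hf : ∀ t : Finset V, ∑ w ∈ t, ‖f w‖ ^ 2 ≤ ‖f‖ ^ 2 := by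
    intro t
    simpa using lp.sum_rpow_le_norm_rpow (p := 2) (by simp) f t
  have h1 : ∀ v, ‖∑ w ∈ nbrs h v, f w‖ ^ 2 ≤ D * ∑ w ∈ nbrs h v, ‖f w‖ ^ 2 := by
    intro v
    calc ‖∑ w ∈ nbrs h v, f w‖ ^ 2 ≤ (∑ w ∈ nbrs h v, ‖f w‖) ^ 2 := by
          gcongr
          exact norm_sum_le _ _
      _ ≤ (nbrs h v).card * ∑ w ∈ nbrs h v, ‖f w‖ ^ 2 := sq_sum_le_card_mul_sum_sq
      _ ≤ D * ∑ w ∈ nbrs h v, ‖f w‖ ^ 2 := by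
          gcongr
          exact hD v
  have h2 : ∑ v ∈ s, ∑ w ∈ nbrs h v, ‖f w‖ ^ 2 ≤ D * ‖f‖ ^ 2 := by
    calc ∑ v ∈ s, ∑ w ∈ nbrs h v, ‖f w‖ ^ 2
        = ∑ w ∈ s.biUnion (nbrs h), ∑ v ∈ s with w ∈ nbrs h v, ‖f w‖ ^ 2 := by
          apply Finset.sum_comm'
          intro v w
          simp only [Finset.mem_filter, Finset.mem_biUnion]
          exact ⟨fun hh => ⟨⟨hh.1, hh.2⟩, v, hh.1, hh.2⟩, fun hh => hh.1⟩
      _ ≤ ∑ w ∈ s.biUnion (nbrs h), D * ‖f w‖ ^ 2 := by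
          refine Finset.sum_le_sum fun w _ => ?_
          rw [Finset.sum_const, nsmul_eq_mul]
          gcongr
          refine le_trans (Finset.card_le_card fun v hv => ?_) (hD w)
          rw [Finset.mem_filter, mem_nbrs] at hv
          exact (mem_nbrs h).2 hv.2.symm
      _ ≤ D * ‖f‖ ^ 2 := by
          rw [← Finset.mul_sum]
          gcongr
          exact hf _
  have h3 : ∑ v ∈ s, ‖∑ w ∈ nbrs h v, f w‖ ^ 2 ≤ ((D : ℝ) * ‖f‖) ^ 2 := by
    calc ∑ v ∈ s, ‖∑ w ∈ nbrs h v, f w‖ ^ 2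
        ≤ ∑ v ∈ s, D * ∑ w ∈ nbrs h v, ‖f w‖ ^ 2 := Finset.sum_le_sum fun v _ => h1 v
      _ = D * ∑ v ∈ s, ∑ w ∈ nbrs h v, ‖f w‖ ^ 2 := by rw [Finset.mul_sum]
      _ ≤ D * (D * ‖f‖ ^ 2) := by gcongr
      _ = ((D : ℝ) * ‖f‖) ^ 2 := by ring
  simpa using h3

/-- The adjacency operator of a uniformly locally finite graph, a bounded operator on `ℓ²(V)`:
`(A f)(v)` is the sum of `f` over the neighbours of `v`. -/
def adjOp {V : Type*} (G : SimpleGraph V) (h : UniformlyLocallyFinite G) :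
    ell2 V →L[ℂ] ell2 V :=
  LinearMap.mkContinuous
    { toFun := fun f => ⟨fun v => ∑ w ∈ nbrs h v, f w,
        memℓp_gen' (sum_nbrs_sq_le h (exists_card_nbrs_le h).choose_spec f)⟩
      map_add' := fun f g => by
        ext v
        exact Finset.sum_add_distrib
      map_smul' := fun c f => by
        ext v
        simp [Finset.mul_sum] }
    ((exists_card_nbrs_le h).choose : ℝ)
    (fun f => lp.norm_le_of_forall_sum_le (by simp) (by positivity)
      (sum_nbrs_sq_le h (exists_card_nbrs_le h).choose_spec f))

theorem adjOp_apply {V : Type*} (G : SimpleGraph V) (h : UniformlyLocallyFinite G)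
    (f : ell2 V) (v : V) : adjOp G h f v = ∑ w ∈ nbrs h v, f w := rfl

/-- On the standard basis: `A e_v = ∑_{w ∼ v} e_w`. -/
theorem adjOp_single {V : Type*} [DecidableEq V] (G : SimpleGraph V)
    (h : UniformlyLocallyFinite G) (v : V) :
    adjOp G h (lp.single 2 v (1 : ℂ)) = ∑ w ∈ nbrs h v, lp.single 2 w (1 : ℂ) := by
  ext u
  rw [adjOp_apply, lp.coeFn_sum, Finset.sum_apply]
  have huv : v ∈ nbrs h u ↔ u ∈ nbrs h v := by
    rw [mem_nbrs, mem_nbrs, SimpleGraph.adj_comm]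
  simp [Pi.single_apply, huv]

/-! ### Spectrum, multiplicity and discrete spectrum of a bounded operator -/

/-- The multiplicity of `z` as an eigenvalue of `T`: the dimension of the eigenspace. -/
def multiplicity {E : Type*} [NormedAddCommGroup E] [NormedSpace ℂ E] (T : E →L[ℂ] E) (z : ℂ) :
    ℕ :=
  Module.finrank ℂ (Module.End.eigenspace (T : E →ₗ[ℂ] E) z)

/-- The discrete spectrum of `T`: the isolated points of the spectrum that are eigenvalues of
finite multiplicity. -/
def discreteSpectrum {E : Type*} [NormedAddCommGroup E] [NormedSpace ℂ E] (T : E →L[ℂ] E) :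
    Set ℂ :=
  {z | z ∈ spectrum ℂ T ∧ (∃ ε > 0, ∀ w ∈ spectrum ℂ T, dist w z < ε → w = z) ∧
    Module.End.HasEigenvalue (T : E →ₗ[ℂ] E) z ∧
    FiniteDimensional ℂ (Module.End.eigenspace (T : E →ₗ[ℂ] E) z)}

/-! ### The comb graph with tail is uniformly locally finite -/

theorem uniformlyLocallyFinite_of_finite {V : Type*} [Finite V] (G : SimpleGraph V) :
    UniformlyLocallyFinite G := by
  refine ⟨Nat.card V, fun v => ?_⟩
  rw [← Set.ncard_univ, Set.Finite.cast_ncard_eq Set.finite_univ]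
  exact Set.encard_le_encard (Set.subset_univ _)

theorem uniformlyLocallyFinite_infPath : UniformlyLocallyFinite infPath := by
  refine ⟨2, fun v => ?_⟩
  have h2 : ({v - 1, v + 1} : Set ℕ).encard ≤ 2 := by
    rw [Set.encard_pair (by omega)]
  refine le_trans (Set.encard_le_encard ?_) h2
  intro w hw
  simp only [infPath, SimpleGraph.mem_neighborSet, SimpleGraph.hasse_adj, Nat.covBy_iff_add_one_eq]
    at hw
  simp only [Set.mem_insert_iff, Set.mem_singleton_iff]
  omega

theorem UniformlyLocallyFinite.coupling {V W : Type*} {G : SimpleGraph V} {H : SimpleGraph W}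
    (hG : UniformlyLocallyFinite G) (hH : UniformlyLocallyFinite H) (v : V) (w : W) :
    UniformlyLocallyFinite (coupling G H v w) := by
  obtain ⟨D, hD⟩ := hG
  obtain ⟨D', hD'⟩ := hH
  refine ⟨D + D' + 1, ?_⟩
  rintro (x | x)
  · have hsub : (CombTail.coupling G H v w).neighborSet (Sum.inl x) ⊆
        Sum.inl '' G.neighborSet x ∪ {Sum.inr w} := by
      rintro (y | y) hy <;>
        simp [CombTail.coupling, SimpleGraph.edge_adj] at hy ⊢ <;> tauto
    refine le_trans (Set.encard_le_encard hsub) (le_trans (Set.encard_union_le _ _) ?_)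
    rw [Set.encard_singleton, Sum.inl_injective.encard_image]
    push_cast
    gcongr
    exact le_trans (hD x) le_self_add
  · have hsub : (CombTail.coupling G H v w).neighborSet (Sum.inr x) ⊆
        Sum.inr '' H.neighborSet x ∪ {Sum.inl v} := by
      rintro (y | y) hy <;>
        simp [CombTail.coupling, SimpleGraph.edge_adj] at hy ⊢ <;> tauto
    refine le_trans (Set.encard_le_encard hsub) (le_trans (Set.encard_union_le _ _) ?_)
    rw [Set.encard_singleton, Sum.inr_injective.encard_image]
    push_cast
    gcongr
    exact le_trans (hD' x) le_add_self

theorem uniformlyLocallyFinite_combTail (n k : ℕ) (hn : 2 ≤ n) (hk : 2 ≤ k) :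
    UniformlyLocallyFinite (combTail n k hn hk) :=
  (uniformlyLocallyFinite_of_finite _).coupling uniformlyLocallyFinite_infPath _ _

/-! ### The objects of the theorem -/

/-- The adjacency operator of `H_{n,k}`. -/
def combTailOp (n k : ℕ) (hn : 2 ≤ n) (hk : 2 ≤ k) :
    ell2 ((Fin n × Fin k) ⊕ ℕ) →L[ℂ] ell2 ((Fin n × Fin k) ⊕ ℕ) :=
  adjOp (combTail n k hn hk) (uniformlyLocallyFinite_combTail n k hn hk)

/-- The part of the discrete spectrum of `H_{n,k}` in `(2, ∞)`. -/
def posDiscreteSpectrum (n k : ℕ) (hn : 2 ≤ n) (hk : 2 ≤ k) : Set ℝ :=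
  {x | 2 < x ∧ (x : ℂ) ∈ discreteSpectrum (combTailOp n k hn hk)}

/-- `ω_k = arccos ((k+1)/(2k))`. -/
def omega (k : ℕ) : ℝ := Real.arccos (((k : ℝ) + 1) / (2 * k))

/-- `a_{n,k} = sin (n ω_k) / sin ((n+1) ω_k)`. -/
def aCoef (n k : ℕ) : ℝ := Real.sin (n * omega k) / Real.sin (((n : ℝ) + 1) * omega k)

/-- The Heaviside function. -/
def heaviside (x : ℝ) : ℤ := if 0 < x then 1 else 0

end CombTail

end

/-! Let `x > 2` and write `x = ξ + ξ⁻¹` with `0 < ξ < 1`. An eigenvector is determined along each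
finger by its free tip: at distance `j` from the tip it is a multiple of `U_j(x)`, with `U_j` the
rescaled Chebyshev polynomials. Eliminating the fingers replaces `x` on the backbone by the
effective parameter `μ = U_k(x) / U_{k-1}(x)`, so the `i`-th backbone value is a multiple of
`U_{i-1}(μ)`. On the tail, boundedness leaves only the decaying mode `ξ^j`. Matching the two gives
the secular equation `U_n(μ) = ξ U_{n-1}(μ)`, and the eigenvalue is simple because one value fixes
the vector.

For `μ ≥ 2` the `U_j(μ)` increase and there is no solution. For `μ = 2 cos φ` the equation says that
the phase `nφ + π/2 - arctan((cos φ - ξ) / sin φ)` lies in `πℤ`. This phase is positive, continuous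
and strictly decreasing in `x`, and falls below `π` near `μ = 2`. So the eigenvalues above `2`
correspond to the integers `m ≥ 1` with `mπ` below the phase at `2`, which is `(n + 1/2) ω_k + π/2`;
counting them gives (ii) (`bijOn_secular`, `setOf_lt_phase_two`).

The condition `μ < 2` bounds the eigenvalues. As `n` grows they become dense in that region, and as
`k` grows `μ` tends to `ξ⁻¹`, so the region fills `[2, 5/2)`; this gives (iii).

Up to finite rank the operator is that of the tail, whose spectrum lies in `[-2, 2]`; hence only
eigenvalues occur outside, while truncated waves on the tail put all of `[-2, 2]` in the spectrum.
The graph is bipartite, which gives the symmetry and transfers simplicity to the negative side. In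
(iv) the multiplicity is thus always one. -/

noncomputable section

namespace CombTail

section

open Real Set

/-! ### Chebyshev polynomials and the decaying root -/

/-- The rescaled Chebyshev polynomials of the second kind:
`cheb (2 cos φ) j = sin ((j + 1) φ) / sin φ`. -/
def cheb (x : ℝ) : ℕ → ℝ
  | 0 => 1
  | 1 => x
  | j + 2 => x * cheb x (j + 1) - cheb x j

theorem cheb_zero (x : ℝ) : cheb x 0 = 1 := rfl

theorem cheb_one (x : ℝ) : cheb x 1 = x := rfl

theorem cheb_add_two (x : ℝ) (j : ℕ) : cheb x (j + 2) = x * cheb x (j + 1) - cheb x j := rfl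

theorem continuous_cheb (j : ℕ) : Continuous fun x => cheb x j := by
  induction j using Nat.twoStepInduction with
  | zero => exact continuous_const
  | one => exact continuous_id
  | more j h1 h2 =>
    simp only [cheb_add_two]
    fun_prop

theorem cheb_two (j : ℕ) : cheb 2 j = j + 1 := by
  induction j using Nat.twoStepInduction with
  | zero => simp [cheb_zero]
  | one => norm_num [cheb_one]
  | more j h1 h2 =>
    rw [cheb_add_two, h1, h2]
    push_cast
    ring

theorem cheb_two_mul_cos (φ : ℝ) (j : ℕ) :
    cheb (2 * cos φ) j * sin φ = sin (((j : ℝ) + 1) * φ) := by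
  induction j using Nat.twoStepInduction with
  | zero => simp [cheb_zero]
  | one =>
    rw [cheb_one, show (((1 : ℕ) : ℝ) + 1) * φ = 2 * φ by push_cast; ring, sin_two_mul]
    ring
  | more j h1 h2 =>
    rw [cheb_add_two, sub_mul, mul_assoc, h1, h2]
    have e1 : ((j + 2 : ℕ) + 1 : ℝ) * φ = ((j + 1 : ℕ) + 1 : ℝ) * φ + φ := by push_cast; ring
    have e2 : ((j : ℝ) + 1) * φ = ((j + 1 : ℕ) + 1 : ℝ) * φ - φ := by push_cast; ring
    rw [e1, e2, sin_add, sin_sub]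
    ring

/-- The root `ξ ≤ 1` of `ξ + ξ⁻¹ = x`, for `2 ≤ x`. -/
def decayRoot (x : ℝ) : ℝ := (x - √(x ^ 2 - 4)) / 2

theorem continuous_decayRoot : Continuous decayRoot := by
  unfold decayRoot
  fun_prop

theorem decayRoot_two : decayRoot 2 = 1 := by norm_num [decayRoot]

theorem decayRoot_sq {x : ℝ} (hx : 2 ≤ x) : decayRoot x ^ 2 = x * decayRoot x - 1 := by
  have h : √(x ^ 2 - 4) ^ 2 = x ^ 2 - 4 := sq_sqrt (by nlinarith)
  unfold decayRoot
  linear_combination h / 4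

theorem decayRoot_pos {x : ℝ} (hx : 2 ≤ x) : 0 < decayRoot x := by
  have h : √(x ^ 2 - 4) < x := by
    rw [sqrt_lt' (by linarith)]
    linarith
  unfold decayRoot
  linarith

theorem decayRoot_le_one {x : ℝ} (hx : 2 ≤ x) : decayRoot x ≤ 1 := by
  have h : x - 2 ≤ √(x ^ 2 - 4) := le_sqrt_of_sq_le (by nlinarith)
  unfold decayRoot
  linarith

theorem decayRoot_mul {x : ℝ} (hx : 2 ≤ x) : decayRoot x * (x - decayRoot x) = 1 := by
  linear_combination -decayRoot_sq hx

theorem strictAntiOn_decayRoot : StrictAntiOn decayRoot (Ici 2) := by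
  intro x hx y hy hxy
  rw [mem_Ici] at hx hy
  by_contra! h
  have h1 := decayRoot_sq hx
  have h2 := decayRoot_sq hy
  have h3 := decayRoot_pos hx
  have h4 := decayRoot_le_one hy
  have h5 := decayRoot_pos hy
  -- This is `ξ + ξ⁻¹ = x` at both points, subtracted and cleared of denominators; the right side is
  -- negative, the left side is not.
  have key : (decayRoot y - decayRoot x) * (1 - decayRoot x * decayRoot y)
      = decayRoot x * decayRoot y * (x - y) := by
    linear_combination decayRoot y * h1 - decayRoot x * h2
  have h6 : 0 ≤ (decayRoot y - decayRoot x) * (1 - decayRoot x * decayRoot y) :=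
    mul_nonneg (by linarith) (by nlinarith [decayRoot_le_one hx])
  nlinarith [mul_pos (mul_pos h3 h5) (sub_pos.2 hxy)]

theorem decayRoot_lt_one {x : ℝ} (hx : 2 < x) : decayRoot x < 1 :=
  decayRoot_two ▸ strictAntiOn_decayRoot (mem_Ici.2 le_rfl) (mem_Ici.2 hx.le) hx

/-- The two claims need each other: the inequality at `j` forces positivity at `j + 1`. It keeps
consecutive ratios above `ξ⁻¹`, the fixed point of `r ↦ x - r⁻¹`. -/
theorem cheb_pos_and_lt {x : ℝ} (hx : 2 ≤ x) (j : ℕ) :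
    0 < cheb x j ∧ cheb x j < decayRoot x * cheb x (j + 1) := by
  have h0 := decayRoot_pos hx
  have h1 := decayRoot_sq hx
  induction j with
  | zero =>
    rw [cheb_zero, cheb_one]
    exact ⟨one_pos, by nlinarith⟩
  | succ j ih =>
    have h2 : 0 < cheb x (j + 1) := by
      by_contra! h
      nlinarith [ih.1, ih.2]
    refine ⟨h2, ?_⟩
    rw [cheb_add_two]
    have h3 : decayRoot x * cheb x j < decayRoot x * (decayRoot x * cheb x (j + 1)) :=
      mul_lt_mul_of_pos_left ih.2 h0
    linear_combination h3 + cheb x (j + 1) * h1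

theorem cheb_pos {x : ℝ} (hx : 2 ≤ x) (j : ℕ) : 0 < cheb x j := (cheb_pos_and_lt hx j).1

theorem cheb_lt_cheb_succ {x : ℝ} (hx : 2 ≤ x) (j : ℕ) : cheb x j < cheb x (j + 1) :=
  (cheb_pos_and_lt hx j).2.trans_le
    (mul_le_of_le_one_left (cheb_pos hx _).le (decayRoot_le_one hx))

/-! ### The effective spectral parameter on the backbone -/

/-- The ratio of consecutive Chebyshev polynomials. -/
def chebRatio (j : ℕ) (x : ℝ) : ℝ := cheb x (j + 1) / cheb x j

theorem chebRatio_zero (x : ℝ) : chebRatio 0 x = x := by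
  simp [chebRatio, cheb_zero, cheb_one]

theorem chebRatio_succ {x : ℝ} (hx : 2 ≤ x) (j : ℕ) :
    chebRatio (j + 1) x = x - (chebRatio j x)⁻¹ := by
  have h := (cheb_pos hx (j + 1)).ne'
  rw [chebRatio, chebRatio, inv_div, cheb_add_two]
  field_simp

theorem inv_decayRoot_lt_chebRatio {x : ℝ} (hx : 2 ≤ x) (j : ℕ) :
    (decayRoot x)⁻¹ < chebRatio j x := by
  rw [chebRatio, lt_div_iff₀ (cheb_pos hx j), inv_mul_lt_iff₀ (decayRoot_pos hx)]
  exact (cheb_pos_and_lt hx j).2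

theorem chebRatio_pos {x : ℝ} (hx : 2 ≤ x) (j : ℕ) : 0 < chebRatio j x :=
  div_pos (cheb_pos hx _) (cheb_pos hx _)

theorem strictMonoOn_chebRatio (j : ℕ) : StrictMonoOn (chebRatio j) (Ici 2) := by
  induction j with
  | zero =>
    intro x _ y _ hxy
    simpa [chebRatio_zero] using hxy
  | succ j ih =>
    intro x hx y hy hxy
    rw [chebRatio_succ hx, chebRatio_succ hy]
    have := inv_strictAnti₀ (chebRatio_pos hx j) (ih hx hy hxy)
    linarith

theorem continuousOn_chebRatio (j : ℕ) : ContinuousOn (chebRatio j) (Ici 2) :=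
  (continuous_cheb _).continuousOn.div (continuous_cheb _).continuousOn
    fun _ hx => (cheb_pos hx j).ne'

theorem chebRatio_two (j : ℕ) : chebRatio j 2 = ((j : ℝ) + 2) / (j + 1) := by
  rw [chebRatio, cheb_two, cheb_two]
  push_cast
  ring

/-- The limit is a fixed point of `r ↦ x - r⁻¹`, and one step multiplies the error by `ξ / r`, which
is at most `ξ < 1` since `r ≥ 1`. -/
theorem tendsto_chebRatio {x : ℝ} (hx : 2 < x) :
    Filter.Tendsto (fun j => chebRatio j x) Filter.atTop (nhds (decayRoot x)⁻¹) := by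
  have h0 := decayRoot_pos hx.le
  have h1 := decayRoot_lt_one hx
  have hb : ∀ j, chebRatio j x - (decayRoot x)⁻¹ ≤ decayRoot x ^ j * x := by
    intro j
    induction j with
    | zero =>
      rw [chebRatio_zero]
      have : 0 < (decayRoot x)⁻¹ := inv_pos.2 h0
      simpa using this.le
    | succ j ih =>
      have hr := chebRatio_pos hx.le j
      have hlt := inv_decayRoot_lt_chebRatio hx.le j
      have hx' : x = decayRoot x + (decayRoot x)⁻¹ := by
        have := decayRoot_mul hx.le
        field_simp
        linarith
      have h3 : (chebRatio j x)⁻¹ ≤ 1 := by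
        refine inv_le_one_of_one_le₀ (le_trans ?_ hlt.le)
        exact (one_le_inv₀ h0).2 h1.le
      calc chebRatio (j + 1) x - (decayRoot x)⁻¹
          = decayRoot x - (chebRatio j x)⁻¹ := by
            rw [chebRatio_succ hx.le]
            linarith
        _ = decayRoot x * (chebRatio j x - (decayRoot x)⁻¹) * (chebRatio j x)⁻¹ := by
            field_simp
        _ ≤ decayRoot x * (chebRatio j x - (decayRoot x)⁻¹) * 1 := by
            refine mul_le_mul_of_nonneg_left h3 (mul_nonneg h0.le (by linarith))
        _ ≤ decayRoot x ^ (j + 1) * x := by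
            rw [mul_one, pow_succ', mul_assoc]
            exact mul_le_mul_of_nonneg_left ih h0.le
  have hz : Filter.Tendsto (fun j => decayRoot x ^ j * x) Filter.atTop (nhds 0) := by
    simpa using (tendsto_pow_atTop_nhds_zero_of_lt_one h0.le h1).mul_const x
  rw [← tendsto_sub_nhds_zero_iff]
  exact squeeze_zero (fun j => by linarith [inv_decayRoot_lt_chebRatio hx.le j]) hb hz

/-! ### The phase function -/

/-- The quasi-momentum `φ` on the backbone: `2 cos φ = chebRatio (k - 1) x`. -/
def quasiMomentum (k : ℕ) (x : ℝ) : ℝ := arccos (chebRatio (k - 1) x / 2)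

/-- The phase whose values in `π ℤ` correspond to the eigenvalues of `H_{n,k}` above `2`. -/
def phase (n k : ℕ) (x : ℝ) : ℝ :=
  n * quasiMomentum k x + π / 2 -
    arctan ((cos (quasiMomentum k x) - decayRoot x) / sin (quasiMomentum k x))

/-- The values of the spectral parameter for which the quasi-momentum is real. -/
def oscRegion (k : ℕ) : Set ℝ := {x | 2 ≤ x ∧ chebRatio (k - 1) x < 2}

theorem two_mul_cos_quasiMomentum {k : ℕ} {x : ℝ} (hx : x ∈ oscRegion k) :
    2 * cos (quasiMomentum k x) = chebRatio (k - 1) x := by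
  have h := chebRatio_pos hx.1 (k - 1)
  have h' := hx.2
  rw [quasiMomentum, cos_arccos] <;> linarith

theorem quasiMomentum_pos {k : ℕ} {x : ℝ} (hx : x ∈ oscRegion k) : 0 < quasiMomentum k x :=
  arccos_pos.2 (by linarith [hx.2])

theorem quasiMomentum_lt {k : ℕ} {x : ℝ} (hx : x ∈ oscRegion k) : quasiMomentum k x < π / 2 :=
  arccos_lt_pi_div_two.2 (by linarith [chebRatio_pos hx.1 (k - 1)])

theorem sin_quasiMomentum_pos {k : ℕ} {x : ℝ} (hx : x ∈ oscRegion k) :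
    0 < sin (quasiMomentum k x) :=
  sin_pos_of_pos_of_lt_pi (quasiMomentum_pos hx) (by linarith [quasiMomentum_lt hx, pi_pos])

theorem strictAntiOn_quasiMomentum (k : ℕ) : StrictAntiOn (quasiMomentum k) (oscRegion k) := by
  intro x hx y hy hxy
  have h1 := chebRatio_pos hx.1 (k - 1)
  have h2 := chebRatio_pos hy.1 (k - 1)
  have h3 := strictMonoOn_chebRatio (k - 1) hx.1 hy.1 hxy
  have h4 := hy.2
  exact strictAntiOn_arccos ⟨by linarith, by linarith⟩ ⟨by linarith, by linarith⟩ (by linarith)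

theorem continuousOn_quasiMomentum (k : ℕ) : ContinuousOn (quasiMomentum k) (Ici 2) :=
  continuous_arccos.comp_continuousOn ((continuousOn_chebRatio _).div_const 2)

theorem oscRegion_subset (k : ℕ) : oscRegion k ⊆ Ici 2 := fun _ hx => hx.1

theorem continuousOn_phase (n k : ℕ) : ContinuousOn (phase n k) (oscRegion k) := by
  have h := (continuousOn_quasiMomentum k).mono (oscRegion_subset k)
  have h' := continuous_decayRoot.continuousOn (s := oscRegion k)
  refine ContinuousOn.sub ((continuousOn_const.mul h).add continuousOn_const)
    (continuous_arctan.comp_continuousOn (ContinuousOn.div ?_ (continuous_sin.comp_continuousOn h)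
      fun x hx => (sin_quasiMomentum_pos hx).ne'))
  exact (continuous_cos.comp_continuousOn h).sub h'

/-- `(cos φ - ξ) / sin φ` decreases in `φ` and in `ξ`. -/
theorem cos_sub_div_sin_le {φ ψ ξ η : ℝ} (hψ : 0 < ψ) (hψφ : ψ ≤ φ) (hφ : φ < π / 2)
    (hηξ : η ≤ ξ) (hη1 : η ≤ 1) :
    (cos φ - ξ) / sin φ ≤ (cos ψ - η) / sin ψ := by
  have hsφ : 0 < sin φ := sin_pos_of_pos_of_lt_pi (by linarith) (by linarith)
  have hsψ : 0 < sin ψ := sin_pos_of_pos_of_lt_pi hψ (by linarith)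
  rw [div_le_div_iff₀ hsφ hsψ]
  -- Since `η ≤ ξ` and `η ≤ 1`, it suffices that `sin φ - sin ψ ≤ sin (φ - ψ)`; both sides share the
  -- factor `2 sin ((φ - ψ) / 2)`.
  have h1 : sin φ - sin ψ = 2 * sin ((φ - ψ) / 2) * cos ((φ + ψ) / 2) := sin_sub_sin φ ψ
  have h2 : sin φ * cos ψ - cos φ * sin ψ = 2 * sin ((φ - ψ) / 2) * cos ((φ - ψ) / 2) := by
    rw [← sin_sub, ← sin_two_mul]
    ring_nf
  have h3 : cos ((φ + ψ) / 2) ≤ cos ((φ - ψ) / 2) :=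
    cos_le_cos_of_nonneg_of_le_pi (by linarith) (by linarith) (by linarith)
  have h4 : 0 ≤ sin ((φ - ψ) / 2) := sin_nonneg_of_nonneg_of_le_pi (by linarith) (by linarith)
  have h5 : sin ψ ≤ sin φ := sin_le_sin_of_le_of_le_pi_div_two (by linarith) hφ.le hψφ
  have h6 : sin φ - sin ψ ≤ sin φ * cos ψ - cos φ * sin ψ := by
    rw [h1, h2]
    exact mul_le_mul_of_nonneg_left h3 (by linarith)
  nlinarith [mul_nonneg (sub_nonneg.2 hηξ) hsψ.le, mul_nonneg (sub_nonneg.2 hη1) (sub_nonneg.2 h5)]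

/-- A quantitative form of the strict monotonicity of the phase. -/
theorem phase_sub_phase_ge (n : ℕ) {k : ℕ} {x y : ℝ} (hx : x ∈ oscRegion k)
    (hy : y ∈ oscRegion k) (hxy : x ≤ y) :
    n * (quasiMomentum k x - quasiMomentum k y) ≤ phase n k x - phase n k y := by
  have h := arctan_mono (cos_sub_div_sin_le (quasiMomentum_pos hy)
    ((strictAntiOn_quasiMomentum k).antitoneOn hx hy hxy) (quasiMomentum_lt hx)
    (strictAntiOn_decayRoot.antitoneOn hx.1 hy.1 hxy) (decayRoot_le_one hy.1))
  unfold phase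
  linarith

theorem strictAntiOn_phase {n : ℕ} (hn : 0 < n) (k : ℕ) :
    StrictAntiOn (phase n k) (oscRegion k) := by
  intro x hx y hy hxy
  have h1 := phase_sub_phase_ge n hx hy hxy.le
  have h2 := strictAntiOn_quasiMomentum k hx hy hxy
  have h3 : (0 : ℝ) < n := by exact_mod_cast hn
  nlinarith

theorem phase_pos (n : ℕ) {k : ℕ} {x : ℝ} (hx : x ∈ oscRegion k) : 0 < phase n k x := by
  have h1 := arctan_lt_pi_div_two
    ((cos (quasiMomentum k x) - decayRoot x) / sin (quasiMomentum k x))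
  have h2 : 0 ≤ n * quasiMomentum k x := mul_nonneg (Nat.cast_nonneg n) (quasiMomentum_pos hx).le
  unfold phase
  linarith

/-- The secular equation for the eigenvalues of `H_{n,k}` above `2`. -/
def Secular (n k : ℕ) (x : ℝ) : Prop :=
  cheb (chebRatio (k - 1) x) n = decayRoot x * cheb (chebRatio (k - 1) x) (n - 1)

theorem mem_oscRegion_of_secular {n k : ℕ} (hn : 0 < n) {x : ℝ} (hx : 2 ≤ x)
    (h : Secular n k x) : x ∈ oscRegion k := by
  refine ⟨hx, ?_⟩
  by_contra! hμ
  obtain ⟨m, rfl⟩ : ∃ m, n = m + 1 := ⟨n - 1, by omega⟩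
  have h1 := cheb_lt_cheb_succ hμ m
  have h2 := mul_le_of_le_one_left (cheb_pos hμ m).le (decayRoot_le_one hx)
  rw [Secular, Nat.add_sub_cancel] at h
  linarith

/-- Multiplied by `sin φ`, the equation reads `sin ((n + 1) φ) = ξ sin (n φ)`. With `tan α = (cos φ
- ξ) / sin φ` this becomes `cos (n φ - α) = 0`, and adding `π / 2` turns the cosine into a sine. -/
theorem secular_iff_sin_phase {n k : ℕ} (hn : 0 < n) {x : ℝ} (hx : x ∈ oscRegion k) :
    Secular n k x ↔ sin (phase n k x) = 0 := by
  have hs := sin_quasiMomentum_pos hx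
  have e1 := cheb_two_mul_cos (quasiMomentum k x) n
  have e2 := cheb_two_mul_cos (quasiMomentum k x) (n - 1)
  rw [two_mul_cos_quasiMomentum hx] at e1 e2
  rw [show (((n - 1 : ℕ) : ℝ) + 1) = n by rw [Nat.cast_sub hn]; push_cast; ring] at e2
  set φ := quasiMomentum k x with hφ
  set α := arctan ((cos φ - decayRoot x) / sin φ) with hα
  have hc : 0 < cos α := cos_arctan_pos _
  have ht : sin α = (cos φ - decayRoot x) / sin φ * cos α := by
    rw [← tan_arctan ((cos φ - decayRoot x) / sin φ), ← hα, tan_mul_cos hc.ne']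
  have hp : sin (phase n k x) * sin φ
      = cos α * (sin (((n : ℝ) + 1) * φ) - decayRoot x * sin (n * φ)) := by
    have : phase n k x = (n * φ - α) + π / 2 := by
      rw [phase, ← hφ, ← hα]
      ring
    rw [this, sin_add_pi_div_two, cos_sub, ht, add_mul (n : ℝ) 1 φ, one_mul, sin_add]
    field_simp
    ring
  rw [← e1, ← e2] at hp
  constructor
  · intro h
    rw [Secular] at h
    rw [h] at hp
    have : sin (phase n k x) * sin φ = 0 := by
      rw [hp]
      ring
    exact (mul_eq_zero.1 this).resolve_right hs.ne'
  · intro h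
    rw [h, zero_mul] at hp
    have h2 := (mul_eq_zero.1 hp.symm).resolve_left hc.ne'
    exact mul_right_cancel₀ hs.ne' (by linarith)

theorem secular_iff {n k : ℕ} (hn : 0 < n) {x : ℝ} (hx : 2 ≤ x) :
    Secular n k x ↔ x ∈ oscRegion k ∧ ∃ m : ℤ, m * π = phase n k x := by
  rw [← sin_eq_zero_iff]
  exact ⟨fun h => ⟨mem_oscRegion_of_secular hn hx h,
      (secular_iff_sin_phase hn (mem_oscRegion_of_secular hn hx h)).1 h⟩,
    fun h => (secular_iff_sin_phase hn h.1).2 h.2⟩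

theorem Icc_subset_oscRegion {k : ℕ} {x y : ℝ} (hx : x ∈ oscRegion k) (hy : y ∈ oscRegion k) :
    Icc x y ⊆ oscRegion k := fun _ hz =>
  ⟨hx.1.trans hz.1, lt_of_le_of_lt
    ((strictMonoOn_chebRatio _).monotoneOn (hx.1.trans hz.1) hy.1 hz.2) hy.2⟩

theorem exists_secular_of_phase {n k : ℕ} (hn : 0 < n) {x y : ℝ} (hx : x ∈ oscRegion k)
    (hy : y ∈ oscRegion k) {m : ℤ} (h1 : phase n k y < m * π) (h2 : m * π < phase n k x)
    (hxy : x ≤ y) :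
    ∃ z ∈ Ioo x y, phase n k z = m * π ∧ Secular n k z := by
  obtain ⟨z, hz, hz'⟩ := intermediate_value_Ioo' hxy
    ((continuousOn_phase n k).mono (Icc_subset_oscRegion hx hy)) ⟨h1, h2⟩
  have hzo := Icc_subset_oscRegion hx hy (Ioo_subset_Icc_self hz)
  exact ⟨z, hz, hz', (secular_iff hn hzo.1).2 ⟨hzo, m, hz'.symm⟩⟩

/-! ### The end points of the oscillation region -/

theorem two_mem_oscRegion {k : ℕ} (hk : 2 ≤ k) : (2 : ℝ) ∈ oscRegion k := by
  obtain ⟨j, rfl⟩ : ∃ j, k = j + 2 := ⟨k - 2, by omega⟩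
  refine ⟨le_rfl, ?_⟩
  rw [chebRatio_two, div_lt_iff₀ (by positivity)]
  push_cast [show j + 2 - 1 = j + 1 by omega]
  have : (0 : ℝ) ≤ j := Nat.cast_nonneg j
  linarith

theorem decayRoot_five_halves : decayRoot (5 / 2) = 1 / 2 := by
  rw [decayRoot, show ((5 : ℝ) / 2) ^ 2 - 4 = (3 / 2) ^ 2 by norm_num, sqrt_sq (by norm_num)]
  norm_num

/-- For every `k` one has `ξ⁻¹ < μ < 2`, while `ξ⁻¹ = 2` exactly at `5 / 2`. -/
theorem lt_of_mem_oscRegion {k : ℕ} {x : ℝ} (hx : x ∈ oscRegion k) : x < 5 / 2 := by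
  by_contra! h
  have h1 := strictAntiOn_decayRoot.antitoneOn (mem_Ici.2 (by norm_num)) hx.1 h
  have h2 := inv_decayRoot_lt_chebRatio hx.1 (k - 1)
  rw [decayRoot_five_halves] at h1
  have h3 := (le_inv_comm₀ (by norm_num : (0 : ℝ) < 2) (decayRoot_pos hx.1)).2 (by linarith)
  linarith [hx.2]

theorem exists_oscRegion_sup {k : ℕ} (hk : 2 ≤ k) :
    ∃ c, 2 < c ∧ chebRatio (k - 1) c = 2 ∧ Ico 2 c ⊆ oscRegion k := by
  have h1 := (two_mem_oscRegion hk).2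
  have h2 : 2 < chebRatio (k - 1) (5 / 2) := by
    have := inv_decayRoot_lt_chebRatio (x := 5 / 2) (by norm_num) (k - 1)
    rw [decayRoot_five_halves] at this
    norm_num at this
    exact this
  obtain ⟨c, hc, hc'⟩ := intermediate_value_Ioo (by norm_num : (2 : ℝ) ≤ 5 / 2)
    ((continuousOn_chebRatio (k - 1)).mono Icc_subset_Ici_self) ⟨h1, h2⟩
  refine ⟨c, hc.1, hc', fun x hx => ⟨hx.1, ?_⟩⟩
  rw [← hc']
  exact strictMonoOn_chebRatio _ hx.1 hc.1.le hx.2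

/-- As `x` increases to the end `c` of the region, `φ` tends to `0` while `cos φ - ξ` tends to `1 -
ξ(c) > 0`. So the arctangent is eventually nonnegative and `n φ < π / 2`. The point `c` itself is
avoided because `sin φ` vanishes there. -/
theorem exists_phase_lt_pi {n k : ℕ} (hn : 0 < n) (hk : 2 ≤ k) :
    ∃ x ∈ oscRegion k, phase n k x < π := by
  obtain ⟨c, hc, hc', hsub⟩ := exists_oscRegion_sup hk
  have hn' : (0 : ℝ) < n := by exact_mod_cast hn
  have hnhds : Ici (2 : ℝ) ∈ nhds c := Ici_mem_nhds hc
  have hr : ContinuousAt (chebRatio (k - 1)) c := (continuousOn_chebRatio _).continuousAt hnhds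
  have hq : ContinuousAt (quasiMomentum k) c := (continuousOn_quasiMomentum k).continuousAt hnhds
  have hqc : quasiMomentum k c = 0 := by simp [quasiMomentum, hc']
  have e1 : ∀ᶠ x in nhds c, n * quasiMomentum k x < π / 2 := by
    refine (continuousAt_const.mul hq).eventually_lt_const ?_
    change n * quasiMomentum k c < π / 2
    rw [hqc, mul_zero]
    positivity
  have e2 : ∀ᶠ x in nhds c, 0 < chebRatio (k - 1) x - 2 * decayRoot x := by
    refine (hr.sub (continuousAt_const.mul continuous_decayRoot.continuousAt)).eventually_const_lt ?_
    change 0 < chebRatio (k - 1) c - 2 * decayRoot c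
    rw [hc']
    linarith [decayRoot_lt_one hc]
  have e3 : ∀ᶠ x in nhds c, 2 < x := Ioi_mem_nhds hc
  obtain ⟨x, ⟨⟨h1, h2⟩, h3⟩, h4⟩ := (((e1.and e2).and e3).filter_mono nhdsWithin_le_nhds |>.and
    (self_mem_nhdsWithin (s := Iio c))).exists
  have hx : x ∈ oscRegion k := hsub ⟨h3.le, h4⟩
  refine ⟨x, hx, ?_⟩
  have h5 : 0 ≤ arctan ((cos (quasiMomentum k x) - decayRoot x) / sin (quasiMomentum k x)) :=
    arctan_nonneg.2 (div_nonneg (by linarith [two_mul_cos_quasiMomentum hx])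
      (sin_quasiMomentum_pos hx).le)
  unfold phase
  linarith

/-! ### Counting the solutions of the secular equation -/

/-- At a solution `phase / π` is an integer, so `round` merely reads it off. Monotonicity gives
injectivity, the intermediate value theorem surjectivity; the bound at `2` is strict because `2`
itself is not counted. -/
theorem bijOn_secular {n k : ℕ} (hn : 0 < n) (hk : 2 ≤ k) :
    BijOn (fun x => round (phase n k x / π)) {x | 2 < x ∧ Secular n k x}
      {m : ℤ | 0 < m ∧ m * π < phase n k 2} := by
  have h2 := two_mem_oscRegion hk
  have hval : ∀ (x : ℝ) (m : ℤ), m * π = phase n k x → round (phase n k x / π) = m := by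
    intro x m h
    rw [← h, mul_div_cancel_right₀ _ pi_pos.ne', round_intCast]
  refine ⟨?_, ?_, ?_⟩
  · rintro x ⟨hx, hs⟩
    obtain ⟨hxo, m, hm⟩ := (secular_iff hn hx.le).1 hs
    simp only [mem_ofPred_eq, hval x m hm]
    constructor
    · have := phase_pos n hxo
      rw [← hm] at this
      exact_mod_cast pos_of_mul_pos_left this pi_pos.le
    · rw [hm]
      exact strictAntiOn_phase hn k h2 hxo hx
  · rintro x ⟨hx, hs⟩ y ⟨hy, hs'⟩ hxy
    obtain ⟨hxo, m, hm⟩ := (secular_iff hn hx.le).1 hs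
    obtain ⟨hyo, m', hm'⟩ := (secular_iff hn hy.le).1 hs'
    simp only [hval x m hm, hval y m' hm'] at hxy
    exact (strictAntiOn_phase hn k).injOn hxo hyo (by rw [← hm, ← hm', hxy])
  · rintro m ⟨hm, hm'⟩
    obtain ⟨y, hy, hy'⟩ := exists_phase_lt_pi hn hk
    have h1 : phase n k y < m * π := by
      have : (1 : ℝ) ≤ m := by exact_mod_cast hm
      nlinarith [pi_pos]
    obtain ⟨z, hz, hz', hzs⟩ := exists_secular_of_phase hn h2 hy h1 hm' hy.1
    exact ⟨z, ⟨hz.1, hzs⟩, hval z m hz'.symm⟩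

/-! ### The phase at the threshold `2` and the number of integers below it -/

theorem quasiMomentum_two {k : ℕ} (hk : 2 ≤ k) : quasiMomentum k 2 = omega k := by
  obtain ⟨j, rfl⟩ : ∃ j, k = j + 2 := ⟨k - 2, by omega⟩
  rw [quasiMomentum, omega, chebRatio_two]
  congr 1
  push_cast [show j + 2 - 1 = j + 1 by omega]
  field_simp
  ring

theorem omega_pos {k : ℕ} (hk : 2 ≤ k) : 0 < omega k :=
  quasiMomentum_two hk ▸ quasiMomentum_pos (two_mem_oscRegion hk)

theorem omega_lt {k : ℕ} (hk : 2 ≤ k) : omega k < π / 2 :=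
  quasiMomentum_two hk ▸ quasiMomentum_lt (two_mem_oscRegion hk)

/-- At `x = 2` one has `ξ = 1`, and `(cos ω - 1) / sin ω = -tan (ω / 2)`. -/
theorem phase_two (n : ℕ) {k : ℕ} (hk : 2 ≤ k) :
    phase n k 2 = n * omega k + omega k / 2 + π / 2 := by
  have h1 := omega_pos hk
  have h2 := omega_lt hk
  have hc : 0 < cos (omega k / 2) := cos_pos_of_mem_Ioo ⟨by linarith, by linarith⟩
  have hs : 0 < sin (omega k / 2) := sin_pos_of_pos_of_lt_pi (by linarith) (by linarith)
  rw [phase, quasiMomentum_two hk, decayRoot_two]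
  have : (cos (omega k) - 1) / sin (omega k) = tan (-(omega k / 2)) := by
    have e : omega k = 2 * (omega k / 2) := by ring
    rw [tan_neg, tan_eq_sin_div_cos]
    have ec : cos (omega k) = 2 * cos (omega k / 2) ^ 2 - 1 := by rw [← cos_two_mul, ← e]
    have es : sin (omega k) = 2 * sin (omega k / 2) * cos (omega k / 2) := by
      rw [← sin_two_mul, ← e]
    rw [ec, es]
    field_simp
    linear_combination 2 * sin_sq_add_cos_sq (omega k / 2)
  rw [this, arctan_tan (by linarith) (by linarith)]
  ring

theorem cos_omega {k : ℕ} (hk : 2 ≤ k) : cos (omega k) = ((k : ℝ) + 1) / (2 * k) := by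
  have h : (2 : ℝ) ≤ k := by exact_mod_cast hk
  rw [omega, cos_arccos]
  · exact le_trans (by norm_num) (by positivity : (0 : ℝ) ≤ _)
  · rw [div_le_one (by positivity)]
    linarith

/-- A zero would make `ω_k` a rational multiple of `π` with rational cosine. That cosine lies
strictly between `1/2` and `1`, which Niven's theorem excludes. -/
theorem sin_mul_omega_ne_zero (n : ℕ) {k : ℕ} (hk : 2 ≤ k) :
    sin (((n : ℝ) + 1) * omega k) ≠ 0 := by
  intro h
  obtain ⟨m, hm⟩ := sin_eq_zero_iff.1 h
  have hk' : (2 : ℝ) ≤ k := by exact_mod_cast hk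
  have h1 : ∃ r : ℚ, omega k = r * π := by
    refine ⟨m / (n + 1), ?_⟩
    have : (n : ℝ) + 1 ≠ 0 := by positivity
    push_cast
    field_simp
    linarith
  have h2 : ∃ q : ℚ, cos (omega k) = q := by
    refine ⟨((k : ℚ) + 1) / (2 * k), ?_⟩
    rw [cos_omega hk]
    push_cast
    rfl
  have h3 : 1 / 2 < cos (omega k) := by
    rw [cos_omega hk, lt_div_iff₀ (by positivity)]
    linarith
  have h4 : cos (omega k) < 1 := by
    rw [cos_omega hk, div_lt_one (by positivity)]
    linarith
  rcases niven h1 h2 with h | h | h | h | h <;>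
    first | linarith | (rw [mem_singleton_iff] at h; linarith)

/-- Write `(n + 1) ω = qπ + β` with `0 ≤ β < π`; the phase is `qπ + (β - ω/2) + π/2`. Since `-π/2 <
β - ω/2 < π`, the integer `q` lies below `phase / π` and `q + 2` does not, while `q + 1` does
exactly when `β - ω/2 > π/2`. By sum-to-product this is `sin (β - ω) > sin β`, that is, `a_{n,k} >
1`. -/
theorem setOf_lt_phase_two (n : ℕ) {k : ℕ} (hk : 2 ≤ k) :
    {m : ℤ | 0 < m ∧ m * π < phase n k 2} =
      Icc 1 (⌊omega k / π * ((n : ℝ) + 1)⌋ + heaviside (aCoef n k - 1)) := by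
  have hπ := pi_pos
  have h1 := omega_pos hk
  have h2 := omega_lt hk
  set q := ⌊omega k / π * ((n : ℝ) + 1)⌋ with hq
  set β := ((n : ℝ) + 1) * omega k - q * π with hβ
  have hx : omega k / π * ((n : ℝ) + 1) * π = ((n : ℝ) + 1) * omega k := by
    field_simp
  have hq1 : (q : ℝ) * π ≤ ((n : ℝ) + 1) * omega k := by
    rw [← hx]
    exact mul_le_mul_of_nonneg_right (Int.floor_le _) hπ.le
  have hq2 : ((n : ℝ) + 1) * omega k < (q + 1) * π := by
    rw [← hx]
    exact mul_lt_mul_of_pos_right (Int.lt_floor_add_one _) hπ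
  have hβ0 : 0 ≤ β := by linarith
  have hβ1 : β < π := by linarith
  have hsin : sin (((n : ℝ) + 1) * omega k) = (-1) ^ q * sin β := by
    rw [show ((n : ℝ) + 1) * omega k = β + q * π by rw [hβ]; ring, sin_add_int_mul_pi]
  have hsin' : sin ((n : ℝ) * omega k) = (-1) ^ q * sin (β - omega k) := by
    rw [show (n : ℝ) * omega k = (β - omega k) + q * π by rw [hβ]; ring, sin_add_int_mul_pi]
  have hβ0' : β ≠ 0 := by
    intro h
    apply sin_mul_omega_ne_zero n hk
    rw [hsin, h, sin_zero, mul_zero]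
  have hβp : 0 < sin β := sin_pos_of_pos_of_lt_pi (lt_of_le_of_ne hβ0 hβ0'.symm) hβ1
  have ha : aCoef n k = sin (β - omega k) / sin β := by
    rw [aCoef, hsin, hsin', mul_div_mul_left]
    exact zpow_ne_zero _ (by norm_num)
  have hhalf : 0 < sin (omega k / 2) := sin_pos_of_pos_of_lt_pi (by linarith) (by linarith)
  have ha' : 0 < aCoef n k - 1 ↔ π / 2 < β - omega k / 2 := by
    have e : sin (β - omega k) - sin β = -(2 * sin (omega k / 2) * cos (β - omega k / 2)) := by
      rw [sin_sub_sin, show (β - omega k - β) / 2 = -(omega k / 2) by ring, sin_neg,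
        show (β - omega k + β) / 2 = β - omega k / 2 by ring]
      ring
    rw [sub_pos, ha, one_lt_div hβp, ← sub_pos, e]
    constructor
    · intro h
      by_contra! h'
      have : 0 ≤ cos (β - omega k / 2) := cos_nonneg_of_mem_Icc ⟨by linarith, h'⟩
      nlinarith
    · intro h
      have : cos (β - omega k / 2) < 0 :=
        cos_neg_of_pi_div_two_lt_of_lt h (by linarith)
      nlinarith
  have hp : phase n k 2 = q * π + (β - omega k / 2) + π / 2 := by
    rw [phase_two n hk, hβ]
    ring
  ext m
  rw [mem_ofPred_eq, mem_Icc, hp]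
  refine and_congr (by omega) ?_
  unfold heaviside
  split_ifs with h
  · rw [ha'] at h
    constructor
    · intro hm
      have : (m : ℝ) * π < (q + 2) * π := by linarith
      have := lt_of_mul_lt_mul_right this hπ.le
      have : m < q + 2 := by exact_mod_cast this
      omega
    · intro hm
      have : (m : ℝ) ≤ q + 1 := by exact_mod_cast hm
      nlinarith
  · rw [ha', not_lt] at h
    constructor
    · intro hm
      have : (m : ℝ) * π < (q + 1) * π := by linarith
      have := lt_of_mul_lt_mul_right this hπ.le
      have : m < q + 1 := by exact_mod_cast this
      omega
    · intro hm
      have : (m : ℝ) ≤ q := by exact_mod_cast (by omega : m ≤ q)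
      nlinarith

theorem finite_secular {n k : ℕ} (hn : 0 < n) (hk : 2 ≤ k) :
    {x | 2 < x ∧ Secular n k x}.Finite := by
  rw [(bijOn_secular hn hk).finite_iff_finite, setOf_lt_phase_two n hk]
  exact finite_Icc _ _

theorem ncard_secular {n k : ℕ} (hn : 0 < n) (hk : 2 ≤ k) :
    ({x | 2 < x ∧ Secular n k x}.ncard : ℤ) =
      ⌊omega k / π * ((n : ℝ) + 1)⌋ + heaviside (aCoef n k - 1) := by
  have hq : 0 ≤ ⌊omega k / π * ((n : ℝ) + 1)⌋ :=
    Int.floor_nonneg.2 (by have := omega_pos hk; positivity)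
  have hh : 0 ≤ heaviside (aCoef n k - 1) := by
    unfold heaviside
    split_ifs <;> norm_num
  rw [← (bijOn_secular hn hk).injOn.ncard_image, (bijOn_secular hn hk).image_eq,
    setOf_lt_phase_two n hk, ← Finset.coe_Icc, ncard_coe_finset, Int.card_Icc]
  omega

/-! ### Location of the solutions -/

/-- For large `n`, there are solutions in each subinterval of the oscillation region. -/
theorem exists_secular_mem_Ioo {k : ℕ} {x y : ℝ} (hx : x ∈ oscRegion k) (hy : y ∈ oscRegion k)
    (hxy : x < y) : ∃ n, 2 ≤ n ∧ ∃ z ∈ Ioo x y, Secular n k z := by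
  have hlt := sub_pos.2 (strictAntiOn_quasiMomentum k hx hy hxy)
  -- For such `N` the phase drops by more than `π` from `x` to `y`, so the first multiple of `π`
  -- above its value at `y` is attained in between.
  obtain ⟨N, hN⟩ := exists_nat_gt (π / (quasiMomentum k x - quasiMomentum k y))
  rw [div_lt_iff₀ hlt] at hN
  have hN' : π < (N + 2 : ℕ) * (quasiMomentum k x - quasiMomentum k y) := by
    push_cast
    nlinarith
  have h := phase_sub_phase_ge (N + 2) hx hy hxy.le
  have hf := Int.lt_floor_add_one (phase (N + 2) k y / π)
  have hf' := Int.floor_le (phase (N + 2) k y / π)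
  rw [div_lt_iff₀ pi_pos] at hf
  rw [le_div_iff₀ pi_pos] at hf'
  obtain ⟨z, hz, -, hzs⟩ := exists_secular_of_phase (n := N + 2) (by omega) hx hy
    (m := ⌊phase (N + 2) k y / π⌋ + 1) (by push_cast; exact hf) (by push_cast; linarith) hxy.le
  exact ⟨N + 2, by omega, z, hz, hzs⟩

/-- For `k = 2` the effective parameter is `x - x⁻¹`, and `x - x⁻¹ < 2` amounts to `(x - 1)² < 2`.
-/
theorem lt_of_mem_oscRegion_two {x : ℝ} (hx : x ∈ oscRegion 2) : x < 1 + √2 := by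
  have h := hx.2
  have h2 := hx.1
  rw [show (2 - 1 : ℕ) = 0 + 1 from rfl, chebRatio_succ hx.1, chebRatio_zero] at h
  have h3 : x * x⁻¹ = 1 := mul_inv_cancel₀ (by linarith)
  have : x - 1 < √2 := lt_sqrt_of_sq_lt (by nlinarith)
  linarith

theorem mem_oscRegion_two {x : ℝ} (hx : 2 ≤ x) (hx' : x < 1 + √2) : x ∈ oscRegion 2 := by
  refine ⟨hx, ?_⟩
  rw [show (2 - 1 : ℕ) = 0 + 1 from rfl, chebRatio_succ hx, chebRatio_zero]
  have h3 : x * x⁻¹ = 1 := mul_inv_cancel₀ (by linarith)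
  have h4 : √2 ^ 2 = 2 := sq_sqrt (by norm_num)
  have h5 : (x - 1) ^ 2 < 2 := by nlinarith [sqrt_nonneg 2]
  by_contra! h
  nlinarith

/-- The effective parameter tends to `ξ⁻¹ < 2` as `k` grows. The point `2` is separate because
geometric convergence needs `ξ < 1`. -/
theorem exists_mem_oscRegion {x : ℝ} (hx : 2 ≤ x) (hx' : x < 5 / 2) :
    ∃ k, 2 ≤ k ∧ x ∈ oscRegion k := by
  rcases hx.eq_or_lt with rfl | hlt
  · exact ⟨2, le_rfl, two_mem_oscRegion le_rfl⟩
  have h1 := strictAntiOn_decayRoot hx (mem_Ici.2 (by norm_num)) hx'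
  rw [decayRoot_five_halves] at h1
  have h2 : (decayRoot x)⁻¹ < 2 := by
    rw [inv_lt_comm₀ (decayRoot_pos hx) (by norm_num)]
    linarith
  obtain ⟨N, hN⟩ := Filter.eventually_atTop.1 ((tendsto_chebRatio hlt).eventually_lt_const h2)
  exact ⟨N + 2, by omega, hx, hN _ (by omega)⟩

end

section

open Set

/-! ### Spectra of bounded operators -/

/-- If `F` has finite rank and `1 - F` is injective, then `1 - F` is surjective. -/
theorem surjective_of_injective_of_finiteDimensional_range {K E : Type*} [Field K]
    [AddCommGroup E] [Module K E] (F : E →ₗ[K] E) [FiniteDimensional K (LinearMap.range F)]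
    (h : Function.Injective (LinearMap.id - F : E →ₗ[K] E)) :
    Function.Surjective (LinearMap.id - F : E →ₗ[K] E) := by
  have hmaps : ∀ x ∈ LinearMap.range F, (LinearMap.id - F : E →ₗ[K] E) x ∈ LinearMap.range F := fun x hx =>
    Submodule.sub_mem _ hx (LinearMap.mem_range_self F x)
  have hinj : Function.Injective ((LinearMap.id - F : E →ₗ[K] E).restrict hmaps) := fun x y hxy =>
    Subtype.ext (h (congrArg Subtype.val hxy))
  intro y
  -- On the finite-dimensional range, injectivity suffices to solve `(1 - F) w = F y`; then `(1 -
  -- F)(y + w) = y - F y + F y`.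
  obtain ⟨w, hw⟩ := LinearMap.injective_iff_surjective.1 hinj ⟨F y, LinearMap.mem_range_self F y⟩
  refine ⟨y + w, ?_⟩
  have hw' : (LinearMap.id - F : E →ₗ[K] E) (w : E) = F y := congrArg Subtype.val hw
  rw [map_add, hw']
  simp

/-- A finite rank perturbation creates only eigenvalues outside the spectrum. -/
theorem hasEigenvalue_of_mem_spectrum {E : Type*} [NormedAddCommGroup E] [NormedSpace ℂ E]
    [CompleteSpace E] {T S : E →L[ℂ] E}
    (hfin : FiniteDimensional ℂ (LinearMap.range ((T - S : E →L[ℂ] E) : E →ₗ[ℂ] E))) {z : ℂ}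
    (hS : z ∉ spectrum ℂ S) (hT : z ∈ spectrum ℂ T) :
    Module.End.HasEigenvalue (T : E →ₗ[ℂ] E) z := by
  by_contra hne
  rw [spectrum.mem_iff] at hT
  rw [spectrum.notMem_iff] at hS
  apply hT
  obtain ⟨u, hu⟩ := hS
  -- With `u = z - S` invertible, `z - T = u (1 - F)` where `F = u⁻¹ (T - S)` has finite rank; if
  -- `z` is no eigenvalue, `1 - F` is injective.
  let F : E →ₗ[ℂ] E := ((u⁻¹ : (E →L[ℂ] E)ˣ) : E →L[ℂ] E).toLinearMap ∘ₗ
    ((T - S : E →L[ℂ] E) : E →ₗ[ℂ] E)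
  have huF : ∀ x, (u : E →L[ℂ] E) (F x) = (T - S) x := by
    intro x
    change ((u : E →L[ℂ] E) * ((u⁻¹ : (E →L[ℂ] E)ˣ) : E →L[ℂ] E)) ((T - S) x) = _
    rw [Units.mul_inv]
    rfl
  have hfac : ∀ x, (algebraMap ℂ (E →L[ℂ] E) z - T) x
      = (u : E →L[ℂ] E) ((LinearMap.id - F : E →ₗ[ℂ] E) x) := by
    intro x
    rw [LinearMap.sub_apply, map_sub, huF, LinearMap.id_apply, hu]
    simp
  have hfinF : FiniteDimensional ℂ (LinearMap.range F) := by
    rw [LinearMap.range_comp]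
    infer_instance
  have hubij : Function.Bijective (u : E →L[ℂ] E) :=
    ContinuousLinearMap.isUnit_iff_bijective.1 u.isUnit
  have hinj : Function.Injective (LinearMap.id - F : E →ₗ[ℂ] E) := by
    rw [injective_iff_map_eq_zero]
    intro x hx
    by_contra hx0
    refine hne (Module.End.hasEigenvalue_of_hasEigenvector (x := x)
      ⟨Module.End.mem_eigenspace_iff.2 ?_, hx0⟩)
    have h := hfac x
    rw [hx, map_zero] at h
    simp only [Algebra.algebraMap_eq_smul_one, sub_apply,
      smul_apply, one_apply_eq_self, sub_eq_zero] at h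
    exact h.symm
  rw [ContinuousLinearMap.isUnit_iff_bijective]
  have : ⇑(algebraMap ℂ (E →L[ℂ] E) z - T) = (u : E →L[ℂ] E) ∘ (LinearMap.id - F : E →ₗ[ℂ] E) :=
    funext hfac
  rw [this]
  exact hubij.comp ⟨hinj, surjective_of_injective_of_finiteDimensional_range F hinj⟩

theorem mem_spectrum_of_hasEigenvalue {E : Type*} [NormedAddCommGroup E] [NormedSpace ℂ E]
    [CompleteSpace E] {T : E →L[ℂ] E} {z : ℂ}
    (h : Module.End.HasEigenvalue (T : E →ₗ[ℂ] E) z) : z ∈ spectrum ℂ T := by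
  obtain ⟨x, hx, hx0⟩ := h.exists_hasEigenvector
  rw [Module.End.mem_eigenspace_iff] at hx
  intro hu
  rw [spectrum.mem_resolventSet_iff, ContinuousLinearMap.isUnit_iff_bijective] at hu
  refine hx0 (hu.1 ?_)
  rw [map_zero]
  simpa [Algebra.algebraMap_eq_smul_one, sub_eq_zero] using hx.symm

/-- A value with approximate eigenvectors lies in the spectrum. -/
theorem mem_spectrum_of_unbounded {E : Type*} [NormedAddCommGroup E] [NormedSpace ℂ E]
    {T : E →L[ℂ] E} {z : ℂ} (C : ℝ)
    (h : ∀ R : ℝ, ∃ x : E, R < ‖x‖ ∧ ‖z • x - T x‖ ≤ C) : z ∈ spectrum ℂ T := by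
  rintro ⟨u, hu⟩
  obtain ⟨x, hx, hx'⟩ := h (‖((u⁻¹ : (E →L[ℂ] E)ˣ) : E →L[ℂ] E)‖ * C)
  have h1 : ((u⁻¹ : (E →L[ℂ] E)ˣ) : E →L[ℂ] E) (z • x - T x) = x := by
    have h2 : z • x - T x = (u : E →L[ℂ] E) x := by
      rw [hu]
      simp [Algebra.algebraMap_eq_smul_one]
    rw [h2]
    change (((u⁻¹ : (E →L[ℂ] E)ˣ) : E →L[ℂ] E) * (u : E →L[ℂ] E)) x = x
    rw [Units.inv_mul]
    rfl
  have h3 := (((u⁻¹ : (E →L[ℂ] E)ˣ) : E →L[ℂ] E)).le_opNorm (z • x - T x)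
  rw [h1] at h3
  have := mul_le_mul_of_nonneg_left hx' (norm_nonneg ((u⁻¹ : (E →L[ℂ] E)ˣ) : E →L[ℂ] E))
  linarith

/-! ### Adjacency operators -/

theorem isSelfAdjoint_adjOp {V : Type*} (G : SimpleGraph V) (h : UniformlyLocallyFinite G) :
    IsSelfAdjoint (adjOp G h) := by
  classical
  rw [ContinuousLinearMap.isSelfAdjoint_iff']
  ext f v
  have key : ∀ g : ell2 V, g v = inner ℂ (lp.single 2 v (1 : ℂ)) g := fun g => by
    rw [lp.inner_single_left]
    simp
  rw [key (ContinuousLinearMap.adjoint (adjOp G h) f), ContinuousLinearMap.adjoint_inner_right,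
    adjOp_single, sum_inner, adjOp_apply]
  refine Finset.sum_congr rfl fun w _ => ?_
  rw [lp.inner_single_left]
  simp

theorem norm_adjOp_le {V : Type*} (G : SimpleGraph V) (h : UniformlyLocallyFinite G) {D : ℕ}
    (hD : ∀ v, (nbrs h v).card ≤ D) : ‖adjOp G h‖ ≤ D :=
  ContinuousLinearMap.opNorm_le_bound _ (Nat.cast_nonneg D) fun f =>
    lp.norm_le_of_forall_sum_le (by simp) (by positivity) (sum_nbrs_sq_le h hD f)

/-- Self-adjointness makes the spectrum real, and the degree bounds the norm. For the tail, `D = 2`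
gives precisely the interval `[-2, 2]`. -/
theorem spectrum_adjOp_subset {V : Type*} [Nonempty V] (G : SimpleGraph V)
    (h : UniformlyLocallyFinite G) {D : ℕ} (hD : ∀ v, (nbrs h v).card ≤ D) :
    spectrum ℂ (adjOp G h) ⊆ Complex.ofReal '' Icc (-(D : ℝ)) D := by
  classical
  have : Nontrivial (ell2 V) := by
    obtain ⟨v⟩ := ‹Nonempty V›
    refine ⟨lp.single 2 v (1 : ℂ), 0, fun h0 => ?_⟩
    have := congrArg norm h0
    rw [lp.norm_single (by norm_num)] at this
    simp at this
  intro z hz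
  have h1 := (isSelfAdjoint_adjOp G h).mem_spectrum_eq_re hz
  have h2 := (spectrum.norm_le_norm_of_mem hz).trans (norm_adjOp_le G h hD)
  refine ⟨z.re, abs_le.1 ?_, h1.symm⟩
  exact (Complex.abs_re_le_norm z).trans h2

/-- The functions supported in a finite set form a finite-dimensional space. -/
theorem finiteDimensional_of_support {V : Type*} {W : Submodule ℂ (ell2 V)} {s : Set V}
    (hs : s.Finite) (h : ∀ f ∈ W, ∀ v ∉ s, f v = 0) : FiniteDimensional ℂ W := by
  have := hs.to_subtype
  let L : W →ₗ[ℂ] (s → ℂ) :=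
    { toFun := fun f v => (f : ell2 V) v
      map_add' := fun f g => by ext; simp
      map_smul' := fun c f => by ext; simp }
  refine FiniteDimensional.of_injective L fun f g hfg => ?_
  ext v
  by_cases hv : v ∈ s
  · exact congrFun hfg ⟨v, hv⟩
  · rw [h f f.2 v hv, h g g.2 v hv]

/-- The graph with the vertices of `G + H` and only the edges of `H`. -/
def rightPart {V : Type*} {W : Type*} (H : SimpleGraph W) : SimpleGraph (V ⊕ W) :=
  (⊥ : SimpleGraph V) ⊕g H

theorem encard_neighborSet_rightPart_le {V : Type*} (v : V ⊕ ℕ) :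
    ((rightPart (V := V) infPath).neighborSet v).encard ≤ (2 : ℕ) := by
  rcases v with v | m
  · have : (rightPart (V := V) infPath).neighborSet (Sum.inl v) = ∅ := by
      ext (w | w) <;> simp [rightPart]
    simp [this]
  · have hsub : (rightPart (V := V) infPath).neighborSet (Sum.inr m) ⊆
        {Sum.inr (m - 1), Sum.inr (m + 1)} := by
      rintro (w | w) hw
      · simp [rightPart] at hw
      · simp only [rightPart, SimpleGraph.mem_neighborSet, SimpleGraph.sum_adj, infPath,
          SimpleGraph.hasse_adj, Nat.covBy_iff_add_one_eq] at hw
        simp only [mem_insert_iff, mem_singleton_iff, Sum.inr.injEq]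
        omega
    exact (encard_le_encard hsub).trans (by rw [encard_pair (by simp)]; rfl)

theorem uniformlyLocallyFinite_rightPart {V : Type*} :
    UniformlyLocallyFinite (rightPart (V := V) infPath) :=
  ⟨2, encard_neighborSet_rightPart_le⟩

theorem card_nbrs_rightPart_le {V : Type*} (v : V ⊕ ℕ) :
    (nbrs (uniformlyLocallyFinite_rightPart (V := V)) v).card ≤ 2 := by
  have := encard_neighborSet_rightPart_le v
  rw [(uniformlyLocallyFinite_rightPart.finite v).encard_eq_coe_toFinset_card] at this
  exact_mod_cast this

/-- Outside `[-2, 2]`, the spectrum of a finite graph with a tail consists of eigenvalues. -/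
theorem hasEigenvalue_of_mem_spectrum_coupling {V : Type*} [Finite V] (G : SimpleGraph V) (v : V)
    (h : UniformlyLocallyFinite (coupling G infPath v 0)) {z : ℂ}
    (hz : z ∈ spectrum ℂ (adjOp (coupling G infPath v 0) h))
    (hz' : z ∉ Complex.ofReal '' Icc (-2) 2) :
    Module.End.HasEigenvalue
      (adjOp (coupling G infPath v 0) h : ell2 (V ⊕ ℕ) →ₗ[ℂ] ell2 (V ⊕ ℕ)) z := by
  refine hasEigenvalue_of_mem_spectrum (S := adjOp _ (uniformlyLocallyFinite_rightPart (V := V)))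
    ?_ (fun hS => hz' ?_) hz
  -- The two operators agree at every tail vertex except the endpoint, so the range of their
  -- difference is supported on a finite set.
  · refine finiteDimensional_of_support (s := range Sum.inl ∪ {Sum.inr 0})
      ((finite_range _).union (finite_singleton _)) ?_
    rintro _ ⟨f, rfl⟩ (w | w) hw
    · simp at hw
    · have hw0 : w ≠ 0 := by simpa using hw
      have : nbrs h (Sum.inr w) = nbrs (uniformlyLocallyFinite_rightPart (V := V)) (Sum.inr w) := by
        ext (u | u) <;> simp [mem_nbrs, coupling, rightPart, SimpleGraph.edge_adj, hw0]
      change adjOp _ h f (Sum.inr w) - adjOp _ uniformlyLocallyFinite_rightPart f (Sum.inr w) = 0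
      rw [adjOp_apply, adjOp_apply, this, sub_self]
  · exact_mod_cast spectrum_adjOp_subset _ _ card_nbrs_rightPart_le hS

end

/-! ### Sign symmetry of bipartite graphs -/

/-- Multiplication by a function with values of modulus one. -/
def signOp {V : Type*} (ε : V → ℂ) (hε : ∀ v, ‖ε v‖ = 1) : ell2 V →ₗ[ℂ] ell2 V where
  toFun f := ⟨fun v => ε v * f v, by
    refine memℓp_gen ?_
    simp only [norm_mul, hε, one_mul]
    exact (lp.memℓp f).summable (by simp)⟩
  map_add' f g := by
    ext v
    exact mul_add _ _ _
  map_smul' c f := by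
    ext v
    exact mul_left_comm _ _ _

theorem signOp_injective {V : Type*} (ε : V → ℂ) (hε : ∀ v, ‖ε v‖ = 1) :
    Function.Injective (signOp ε hε) := by
  rw [injective_iff_map_eq_zero]
  intro f hf
  ext v
  have h : ε v * f v = 0 := congrArg (fun g : ell2 V => g v) hf
  have hv : ε v ≠ 0 := fun h0 => by simpa [h0] using hε v
  exact (mul_eq_zero.1 h).resolve_left hv

theorem adjOp_signOp {V : Type*} (G : SimpleGraph V) (h : UniformlyLocallyFinite G) (ε : V → ℂ)
    (hε : ∀ v, ‖ε v‖ = 1) (hG : ∀ v w, G.Adj v w → ε w = -ε v) (f : ell2 V) :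
    adjOp G h (signOp ε hε f) = -signOp ε hε (adjOp G h f) := by
  ext v
  change ∑ w ∈ nbrs h v, ε w * f w = -(ε v * ∑ w ∈ nbrs h v, f w)
  rw [Finset.mul_sum, ← Finset.sum_neg_distrib]
  refine Finset.sum_congr rfl fun w hw => ?_
  rw [hG v w ((mem_nbrs h).1 hw), neg_mul]

/-- In a bipartite graph, the eigenspace of `z` embeds into the eigenspace of `-z`. -/
theorem exists_injective_eigenspace_neg {V : Type*} (G : SimpleGraph V)
    (h : UniformlyLocallyFinite G) (ε : V → ℂ) (hε : ∀ v, ‖ε v‖ = 1)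
    (hG : ∀ v w, G.Adj v w → ε w = -ε v) (z : ℂ) :
    ∃ L : Module.End.eigenspace (adjOp G h : ell2 V →ₗ[ℂ] ell2 V) z →ₗ[ℂ]
      Module.End.eigenspace (adjOp G h : ell2 V →ₗ[ℂ] ell2 V) (-z), Function.Injective L := by
  have hmaps : ∀ f ∈ Module.End.eigenspace (adjOp G h : ell2 V →ₗ[ℂ] ell2 V) z,
      signOp ε hε f ∈ Module.End.eigenspace (adjOp G h : ell2 V →ₗ[ℂ] ell2 V) (-z) := by
    intro f hf
    rw [Module.End.mem_eigenspace_iff] at hf ⊢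
    change adjOp G h f = z • f at hf
    change adjOp G h (signOp ε hε f) = -z • signOp ε hε f
    rw [adjOp_signOp G h ε hε hG, hf, map_smul, neg_smul]
  exact ⟨(signOp ε hε).restrict hmaps, fun f g hfg =>
    Subtype.ext (signOp_injective ε hε (congrArg Subtype.val hfg))⟩

/-! ### Coordinates on the comb graph with tail -/

/-- The position of a vertex: the first coordinate runs through backbone and tail, the second
one along the fingers; both start at `1`. -/
def gridPos (n k : ℕ) : (Fin n × Fin k) ⊕ ℕ → ℕ × ℕ
  | Sum.inl (i, j) => (i + 1, j + 1)
  | Sum.inr m => (n + 1 + m, 1)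

theorem gridPos_injective (n k : ℕ) : Function.Injective (gridPos n k) := by
  rintro (⟨⟨i, hi⟩, ⟨j, hj⟩⟩ | m) (⟨⟨i', hi'⟩, ⟨j', hj'⟩⟩ | m') h <;>
    simp only [gridPos, Prod.mk.injEq, Sum.inl.injEq, Sum.inr.injEq, Fin.mk.injEq, reduceCtorEq]
      at h ⊢ <;> omega

theorem adj_iff_gridPos {n k : ℕ} (hn : 2 ≤ n) (hk : 2 ≤ k) (v w : (Fin n × Fin k) ⊕ ℕ) :
    (combTail n k hn hk).Adj v w ↔
      ((gridPos n k v).2 = 1 ∧ (gridPos n k w).2 = 1 ∧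
        ((gridPos n k v).1 + 1 = (gridPos n k w).1 ∨
          (gridPos n k w).1 + 1 = (gridPos n k v).1)) ∨
      ((gridPos n k v).1 = (gridPos n k w).1 ∧
        ((gridPos n k v).2 + 1 = (gridPos n k w).2 ∨
          (gridPos n k w).2 + 1 = (gridPos n k v).2)) := by
  rcases v with ⟨⟨i, hi⟩, ⟨j, hj⟩⟩ | m <;> rcases w with ⟨⟨i', hi'⟩, ⟨j', hj'⟩⟩ | m' <;>
    simp only [combTail, coupling, combGraph, combProduct, infPath, gridPos,
      SimpleGraph.sup_adj, SimpleGraph.sum_adj, SimpleGraph.edge_adj, SimpleGraph.pathGraph_adj,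
      SimpleGraph.hasse_adj, Nat.covBy_iff_add_one_eq, Fin.mk.injEq, Prod.mk.injEq,
      Sum.inl.injEq, Sum.inr.injEq, reduceCtorEq, false_and, and_false, or_false, false_or,
      ne_eq, not_false_eq_true, and_true, true_and] <;> omega

/-- A function on the vertices as a function of the positions, extended by zero. -/
def gridExt {n k : ℕ} (f : ell2 ((Fin n × Fin k) ⊕ ℕ)) (i j : ℕ) : ℂ :=
  Function.extend (gridPos n k) f 0 (i, j)

theorem gridExt_of_gridPos {n k : ℕ} (f : ell2 ((Fin n × Fin k) ⊕ ℕ))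
    {v : (Fin n × Fin k) ⊕ ℕ} {i j : ℕ} (h : gridPos n k v = (i, j)) : gridExt f i j = f v := by
  rw [gridExt, ← h, (gridPos_injective n k).extend_apply]

theorem gridExt_inl {n k : ℕ} (f : ell2 ((Fin n × Fin k) ⊕ ℕ)) {i j : ℕ} (hi : i < n)
    (hj : j < k) : gridExt f (i + 1) (j + 1) = f (Sum.inl (⟨i, hi⟩, ⟨j, hj⟩)) :=
  gridExt_of_gridPos f rfl

theorem gridExt_inr {n k : ℕ} (f : ell2 ((Fin n × Fin k) ⊕ ℕ)) (m : ℕ) :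
    gridExt f (n + 1 + m) 1 = f (Sum.inr m) :=
  gridExt_of_gridPos f rfl

/-- These zeros before the backbone, beyond the tips and beside the tail act as Dirichlet
conditions, so end vertices obey the same recurrences as inner ones. -/
theorem gridExt_eq_zero {n k : ℕ} (f : ell2 ((Fin n × Fin k) ⊕ ℕ)) {i j : ℕ}
    (h : i = 0 ∨ (i ≤ n ∧ k < j) ∨ (n < i ∧ 1 < j)) : gridExt f i j = 0 := by
  rw [gridExt, Function.extend_apply']
  · rfl
  · rintro ⟨(⟨⟨i', hi'⟩, ⟨j', hj'⟩⟩ | m), hv⟩ <;> simp only [gridPos, Prod.mk.injEq] at hv <;> omega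

theorem norm_gridExt_le {n k : ℕ} (f : ell2 ((Fin n × Fin k) ⊕ ℕ)) (i j : ℕ) :
    ‖gridExt f i j‖ ≤ ‖f‖ := by
  by_cases h : ∃ v, gridPos n k v = (i, j)
  · obtain ⟨v, hv⟩ := h
    rw [gridExt_of_gridPos f hv]
    exact lp.norm_apply_le_norm (by simp) f v
  · rw [gridExt, Function.extend_apply' _ _ _ h]
    simp

/-- The set `s` may contain positions without a vertex; the extension by zero makes them harmless.
-/
theorem combTailOp_eq_sum {n k : ℕ} (hn : 2 ≤ n) (hk : 2 ≤ k) (f : ell2 ((Fin n × Fin k) ⊕ ℕ))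
    (v : (Fin n × Fin k) ⊕ ℕ) (s : Finset (ℕ × ℕ))
    (hs : ∀ w, (combTail n k hn hk).Adj v w ↔ gridPos n k w ∈ s) :
    combTailOp n k hn hk f v = ∑ q ∈ s, gridExt f q.1 q.2 := by
  have h1 : combTailOp n k hn hk f v =
      ∑ w ∈ nbrs (uniformlyLocallyFinite_combTail n k hn hk) v,
        gridExt f (gridPos n k w).1 (gridPos n k w).2 := by
    rw [combTailOp, adjOp_apply]
    exact Finset.sum_congr rfl fun w _ => (gridExt_of_gridPos f rfl).symm
  rw [h1, ← Finset.sum_image (f := fun q : ℕ × ℕ => gridExt f q.1 q.2)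
    (gridPos_injective n k).injOn]
  refine Finset.sum_subset (fun q hq => ?_) fun q hq hq' => ?_
  · obtain ⟨w, hw, rfl⟩ := Finset.mem_image.1 hq
    exact (hs w).1 ((mem_nbrs _).1 hw)
  · rw [gridExt, Function.extend_apply']
    · rfl
    · rintro ⟨w, hw : gridPos n k w = q⟩
      subst hw
      exact hq' (Finset.mem_image_of_mem _ ((mem_nbrs _).2 ((hs w).2 hq)))

theorem combTailOp_finger {n k : ℕ} (hn : 2 ≤ n) (hk : 2 ≤ k)
    (f : ell2 ((Fin n × Fin k) ⊕ ℕ)) {v : (Fin n × Fin k) ⊕ ℕ} {i j : ℕ}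
    (hv : gridPos n k v = (i, j + 2)) :
    combTailOp n k hn hk f v = gridExt f i (j + 1) + gridExt f i (j + 3) := by
  rw [combTailOp_eq_sum hn hk f v {(i, j + 1), (i, j + 3)} fun w => ?_,
    Finset.sum_pair (by simp)]
  rw [adj_iff_gridPos, hv]
  simp only [Finset.mem_insert, Finset.mem_singleton, Prod.ext_iff]
  omega

theorem combTailOp_backbone {n k : ℕ} (hn : 2 ≤ n) (hk : 2 ≤ k)
    (f : ell2 ((Fin n × Fin k) ⊕ ℕ)) {v : (Fin n × Fin k) ⊕ ℕ} {i : ℕ}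
    (hv : gridPos n k v = (i + 1, 1)) :
    combTailOp n k hn hk f v =
      gridExt f i 1 + gridExt f (i + 2) 1 + gridExt f (i + 1) 2 := by
  have hpos : ∀ w, 0 < (gridPos n k w).2 := by
    rintro (⟨i, j⟩ | m) <;> simp [gridPos]
  rw [combTailOp_eq_sum hn hk f v {(i, 1), (i + 2, 1), (i + 1, 2)} fun w => ?_,
    Finset.sum_insert (by simp), Finset.sum_pair (by simp), add_assoc]
  have := hpos w
  rw [adj_iff_gridPos, hv]
  simp only [Finset.mem_insert, Finset.mem_singleton, Prod.ext_iff, true_and]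
  omega

/-- The eigenvalue equation in coordinates. -/
theorem combTailOp_eq_smul_iff {n k : ℕ} (hn : 2 ≤ n) (hk : 2 ≤ k)
    (f : ell2 ((Fin n × Fin k) ⊕ ℕ)) (z : ℂ) :
    combTailOp n k hn hk f = z • f ↔
      (∀ i < n, ∀ j, j + 2 ≤ k → gridExt f (i + 1) (j + 1) + gridExt f (i + 1) (j + 3) =
        z * gridExt f (i + 1) (j + 2)) ∧
      (∀ i, gridExt f i 1 + gridExt f (i + 2) 1 + gridExt f (i + 1) 2 =
        z * gridExt f (i + 1) 1) := by
  constructor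
  · intro h
    have h' : ∀ v, combTailOp n k hn hk f v = z * f v := fun v => by
      rw [h]
      rfl
    refine ⟨fun i hi j hj => ?_, fun i => ?_⟩
    · have hv : gridPos n k (Sum.inl (⟨i, hi⟩, ⟨j + 1, by omega⟩)) = (i + 1, j + 2) := rfl
      rw [← combTailOp_finger hn hk f hv, gridExt_of_gridPos f hv, h']
    · obtain ⟨v, hv⟩ : ∃ v, gridPos n k v = (i + 1, 1) := by
        by_cases hi : i < n
        · exact ⟨Sum.inl (⟨i, hi⟩, ⟨0, by omega⟩), rfl⟩
        · refine ⟨Sum.inr (i - n), ?_⟩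
          simp only [gridPos, Prod.mk.injEq, and_true]
          omega
      rw [← combTailOp_backbone hn hk f hv, gridExt_of_gridPos f hv, h']
  · rintro ⟨h1, h2⟩
    ext v
    change combTailOp n k hn hk f v = z * f v
    rcases hv : gridPos n k v with ⟨i, j⟩
    have hb : (1 ≤ i ∧ j = 1) ∨ (1 ≤ i ∧ i ≤ n ∧ 2 ≤ j ∧ j ≤ k) := by
      rcases v with ⟨⟨i', hi'⟩, ⟨j', hj'⟩⟩ | m <;> simp only [gridPos, Prod.mk.injEq] at hv <;> omega
    rcases hb with ⟨hi, rfl⟩ | ⟨hi, hi', hj, hj'⟩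
    · obtain ⟨i, rfl⟩ : ∃ a, i = a + 1 := ⟨i - 1, by omega⟩
      rw [combTailOp_backbone hn hk f hv, h2, gridExt_of_gridPos f hv]
    · obtain ⟨i, rfl⟩ : ∃ a, i = a + 1 := ⟨i - 1, by omega⟩
      obtain ⟨j, rfl⟩ : ∃ a, j = a + 2 := ⟨j - 2, by omega⟩
      rw [combTailOp_finger hn hk f hv, h1 i (by omega) j hj', gridExt_of_gridPos f hv]

/-! ### Eigenvectors for eigenvalues above two -/

theorem eq_mul_cheb_of_recurrence {y : ℕ → ℂ} {x : ℝ} {N : ℕ} (h0 : y 0 = 0)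
    (h : ∀ i < N, y i + y (i + 2) = x * y (i + 1)) :
    ∀ i ≤ N, y (i + 1) = y 1 * cheb x i := by
  intro i
  induction i using Nat.twoStepInduction with
  | zero => simp [cheb_zero]
  | one =>
    intro h1
    have := h 0 (by omega)
    rw [h0, zero_add] at this
    rw [this, cheb_one, mul_comm]
  | more i ih1 ih2 =>
    intro hi
    have := h (i + 1) (by omega)
    rw [ih1 (by omega), ih2 (by omega)] at this
    rw [cheb_add_two]
    push_cast
    linear_combination this

/-- A bounded solution of the free recurrence decays geometrically. -/
theorem eq_pow_mul_of_bounded_recurrence {y : ℕ → ℂ} {x C : ℝ} (hx : 2 < x)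
    (hC : ∀ j, ‖y j‖ ≤ C) (h : ∀ j, y j + y (j + 2) = x * y (j + 1)) (j : ℕ) :
    y j = (decayRoot x : ℂ) ^ j * y 0 := by
  have h0 := decayRoot_pos hx.le
  have h1 := decayRoot_lt_one hx
  have hsq : (decayRoot x : ℂ) ^ 2 = x * decayRoot x - 1 := by
    exact_mod_cast decayRoot_sq hx.le
  have hC0 : 0 ≤ C := (norm_nonneg _).trans (hC 0)
  -- The combination `y (i + 1) - ξ y i` isolates the growing mode: each step multiplies it by
  -- `ξ⁻¹`, so boundedness forces it to vanish.
  have hstep : ∀ i m, y (i + 1) - decayRoot x * y i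
      = (decayRoot x : ℂ) ^ m * (y (i + m + 1) - decayRoot x * y (i + m)) := by
    intro i m
    induction m with
    | zero => simp
    | succ m ih =>
      rw [ih, pow_succ]
      have := h (i + m)
      linear_combination (-(decayRoot x : ℂ) ^ m * decayRoot x) * this
        + (decayRoot x : ℂ) ^ m * y (i + m + 1) * hsq
  have hzero : ∀ i, y (i + 1) = decayRoot x * y i := by
    intro i
    have hb : ∀ m, ‖y (i + 1) - decayRoot x * y i‖ ≤ decayRoot x ^ m * (2 * C) := by
      intro m
      rw [hstep i m, norm_mul, norm_pow, Complex.norm_real, Real.norm_of_nonneg h0.le]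
      refine mul_le_mul_of_nonneg_left ?_ (pow_nonneg h0.le m)
      refine (norm_sub_le _ _).trans ?_
      rw [norm_mul, Complex.norm_real, Real.norm_of_nonneg h0.le]
      have h2 := hC (i + m + 1)
      have h3 := mul_le_mul h1.le (hC (i + m)) (norm_nonneg _) zero_le_one
      linarith
    have hlim : Filter.Tendsto (fun m => decayRoot x ^ m * (2 * C)) Filter.atTop (nhds 0) := by
      simpa using (tendsto_pow_atTop_nhds_zero_of_lt_one h0.le h1).mul_const (2 * C)
    have := ge_of_tendsto' hlim hb
    exact sub_eq_zero.1 (norm_le_zero_iff.1 this)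
  induction j with
  | zero => simp
  | succ j ih => rw [hzero, ih, pow_succ']; ring

/-- The form of an eigenvector for an eigenvalue `x > 2`. -/
theorem eigenvector_form {n k : ℕ} (hn : 2 ≤ n) (hk : 2 ≤ k) {x : ℝ} (hx : 2 < x)
    {f : ell2 ((Fin n × Fin k) ⊕ ℕ)} (hf : combTailOp n k hn hk f = (x : ℂ) • f) :
    (∀ i ≤ n, gridExt f (i + 1) 1 = gridExt f 1 1 * cheb (chebRatio (k - 1) x) i) ∧
    (∀ j, gridExt f (n + j) 1 = (decayRoot x : ℂ) ^ j * gridExt f n 1) ∧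
    (∀ i < n, ∀ j < k, gridExt f (i + 1) (k - j) * cheb x (k - 1) =
      gridExt f (i + 1) 1 * cheb x j) := by
  obtain ⟨h1, h2⟩ := (combTailOp_eq_smul_iff hn hk f x).1 hf
  have hfinger : ∀ i < n, ∀ j ≤ k - 1, gridExt f (i + 1) (k - j) =
      gridExt f (i + 1) k * cheb x j := by
    intro i hi j hj
    -- The finger is read backwards, from the zero just beyond its tip.
    have := eq_mul_cheb_of_recurrence (y := fun j => gridExt f (i + 1) (k + 1 - j)) (x := x)
      (N := k - 1) (gridExt_eq_zero f (by omega)) (fun j hj => ?_) j hj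
    · simpa [show k + 1 - (j + 1) = k - j by omega] using this
    · have := h1 i hi (k - 2 - j) (by omega)
      rw [show k - 2 - j + 1 = k + 1 - (j + 2) by omega,
        show k - 2 - j + 2 = k + 1 - (j + 1) by omega,
        show k - 2 - j + 3 = k + 1 - j by omega] at this
      linear_combination this
  have hbase : ∀ i < n, gridExt f (i + 1) 1 = gridExt f (i + 1) k * cheb x (k - 1) := by
    intro i hi
    have := hfinger i hi (k - 1) le_rfl
    rwa [show k - (k - 1) = 1 by omega] at this
  have hmu : (chebRatio (k - 1) x : ℂ) * cheb x (k - 1) = x * cheb x (k - 1) - cheb x (k - 2) := by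
    obtain ⟨p, rfl⟩ : ∃ p, k = p + 2 := ⟨k - 2, by omega⟩
    have : chebRatio (p + 1) x * cheb x (p + 1) = cheb x (p + 2) :=
      div_mul_cancel₀ _ (cheb_pos hx.le (p + 1)).ne'
    rw [cheb_add_two] at this
    exact_mod_cast this
  refine ⟨?_, ?_, ?_⟩
  · refine eq_mul_cheb_of_recurrence (y := fun i => gridExt f i 1)
      (gridExt_eq_zero f (by omega)) fun i hi => ?_
    have e1 := h2 i
    have e2 := hbase i hi
    have e3 := hfinger i hi (k - 2) (by omega)
    rw [show k - (k - 2) = 2 by omega] at e3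
    rw [e3] at e1
    linear_combination e1 + (x - (chebRatio (k - 1) x : ℂ)) * e2
      - gridExt f (i + 1) k * hmu
  -- The sequence starts at the last backbone vertex: the decay law already relates it to the first
  -- tail vertex.
  · refine eq_pow_mul_of_bounded_recurrence (y := fun j => gridExt f (n + j) 1) (C := ‖f‖) hx
      (fun j => norm_gridExt_le f _ _) fun j => ?_
    have := h2 (n + j)
    rw [gridExt_eq_zero f (i := n + j + 1) (j := 2) (by omega), add_zero] at this
    exact this
  · intro i hi j hj
    rw [hfinger i hi j (by omega), hbase i hi]
    ring

theorem eigenvector_eq_zero {n k : ℕ} (hn : 2 ≤ n) (hk : 2 ≤ k) {x : ℝ} (hx : 2 < x)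
    {f : ell2 ((Fin n × Fin k) ⊕ ℕ)} (hf : combTailOp n k hn hk f = (x : ℂ) • f)
    (h0 : gridExt f 1 1 = 0) : f = 0 := by
  obtain ⟨h1, h2, h3⟩ := eigenvector_form hn hk hx hf
  have hb : ∀ i ≤ n, gridExt f (i + 1) 1 = 0 := fun i hi => by rw [h1 i hi, h0, zero_mul]
  have hc0 : (cheb x (k - 1) : ℂ) ≠ 0 := by
    exact_mod_cast (cheb_pos hx.le (k - 1)).ne'
  ext v
  rcases v with ⟨⟨i, hi⟩, ⟨j, hj⟩⟩ | m
  · rw [← gridExt_inl f hi hj]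
    have := h3 i hi (k - 1 - j) (by omega)
    rw [hb i hi.le, zero_mul, show k - (k - 1 - j) = j + 1 by omega] at this
    exact (mul_eq_zero.1 this).resolve_right hc0
  · rw [← gridExt_inr f m, add_assoc, h2]
    have := hb (n - 1) (by omega)
    rw [show n - 1 + 1 = n by omega] at this
    rw [this, mul_zero]
    rfl

/-- The backbone and tail formulas must agree at position `n + 1`; the common factor, the value at
the free end of the backbone, cannot vanish. -/
theorem secular_of_eigenvector {n k : ℕ} (hn : 2 ≤ n) (hk : 2 ≤ k) {x : ℝ} (hx : 2 < x)
    {f : ell2 ((Fin n × Fin k) ⊕ ℕ)} (hf : combTailOp n k hn hk f = (x : ℂ) • f) (hf0 : f ≠ 0) :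
    Secular n k x := by
  obtain ⟨h1, h2, -⟩ := eigenvector_form hn hk hx hf
  have h0 : gridExt f 1 1 ≠ 0 := fun h => hf0 (eigenvector_eq_zero hn hk hx hf h)
  have e1 := h1 n le_rfl
  have e2 := h1 (n - 1) (by omega)
  rw [show n - 1 + 1 = n by omega] at e2
  have e3 := h2 1
  rw [e1, e2, pow_one] at e3
  have : (cheb (chebRatio (k - 1) x) n : ℂ)
      = decayRoot x * cheb (chebRatio (k - 1) x) (n - 1) :=
    mul_left_cancel₀ h0 (by linear_combination e3)
  exact_mod_cast this

/-- The eigenvector built from a solution of the secular equation. -/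
def secularFun (n k : ℕ) (x : ℝ) : (Fin n × Fin k) ⊕ ℕ → ℂ
  | Sum.inl (i, j) => cheb (chebRatio (k - 1) x) i * cheb x (k - 1 - j)
  | Sum.inr m => cheb (chebRatio (k - 1) x) n * cheb x (k - 1) * decayRoot x ^ m

theorem memℓp_secularFun (n k : ℕ) {x : ℝ} (hx : 2 < x) : Memℓp (secularFun n k x) 2 := by
  have h0 := decayRoot_pos hx.le
  have h1 := decayRoot_lt_one hx
  refine memℓp_gen ?_
  refine Summable.sum _ (Summable.of_finite) ?_
  simp only [Function.comp_def, secularFun, norm_mul, norm_pow, Complex.norm_real,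
    Real.norm_of_nonneg h0.le, ENNReal.toReal_ofNat, Real.rpow_ofNat, mul_pow, ← pow_mul,
    mul_comm _ 2]
  simp only [pow_mul]
  exact (summable_geometric_of_lt_one (by positivity) (pow_lt_one₀ h0.le h1 two_ne_zero)).mul_left _

theorem exists_eigenvector_of_secular {n k : ℕ} (hn : 2 ≤ n) (hk : 2 ≤ k) {x : ℝ} (hx : 2 < x)
    (hs : Secular n k x) :
    ∃ f : ell2 ((Fin n × Fin k) ⊕ ℕ), f ≠ 0 ∧ combTailOp n k hn hk f = (x : ℂ) • f := by
  let f : ell2 ((Fin n × Fin k) ⊕ ℕ) := ⟨secularFun n k x, memℓp_secularFun n k hx⟩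
  set μ := chebRatio (k - 1) x with hμ
  set ξ := decayRoot x with hξ
  have hsq : (ξ : ℂ) ^ 2 = x * ξ - 1 := by
    exact_mod_cast decayRoot_sq hx.le
  have hs' : (cheb μ n : ℂ) = ξ * cheb μ (n - 1) := by exact_mod_cast hs
  obtain ⟨p, rfl⟩ : ∃ p, k = p + 2 := ⟨k - 2, by omega⟩
  have hmu : (μ : ℂ) * cheb x (p + 1) = x * cheb x (p + 1) - cheb x p := by
    have : μ * cheb x (p + 1) = cheb x (p + 2) :=
      div_mul_cancel₀ _ (cheb_pos hx.le (p + 1)).ne'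
    rw [cheb_add_two] at this
    exact_mod_cast this
  have hF : ∀ i < n, ∀ j < p + 2, gridExt f (i + 1) (j + 1) = cheb μ i * cheb x (p + 1 - j) := by
    intro i hi j hj
    rw [gridExt_inl f hi hj]
    rfl
  have hT : ∀ m, gridExt f (n + 1 + m) 1 = cheb μ n * cheb x (p + 1) * (ξ : ℂ) ^ m := fun m =>
    gridExt_inr f m
  have hB : ∀ i ≤ n, gridExt f (i + 1) 1 = cheb μ i * cheb x (p + 1) := by
    intro i hi
    -- Position `n + 1` lies on the tail, but its value continues the backbone formula.
    rcases hi.eq_or_lt with rfl | hi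
    · simpa using hT 0
    · simpa using hF i hi 0 (by omega)
  refine ⟨f, fun h => ?_, (combTailOp_eq_smul_iff hn hk f x).2 ⟨fun i hi j hj => ?_, fun i => ?_⟩⟩
  -- The value at the tip of the first finger is `1`.
  · have h1 : f (Sum.inl (⟨0, by omega⟩, ⟨p + 1, by omega⟩)) = 0 := by
      rw [h]
      rfl
    change (cheb μ 0 * cheb x (p + 1 - (p + 1)) : ℂ) = 0 at h1
    simp [cheb_zero] at h1
  · rw [hF i hi j (by omega), hF i hi (j + 1) (by omega)]
    rcases (show j = p ∨ j + 1 ≤ p by omega) with rfl | hj'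
    · rw [gridExt_eq_zero f (i := i + 1) (j := j + 3) (by omega),
        show j + 1 - j = 1 by omega, show j + 1 - (j + 1) = 0 by omega, cheb_one, cheb_zero]
      push_cast
      ring
    · rw [hF i hi (j + 2) (by omega), show p + 1 - j = (p + 1 - (j + 2)) + 2 by omega,
        show p + 1 - (j + 1) = (p + 1 - (j + 2)) + 1 by omega, cheb_add_two]
      push_cast
      ring
  · rcases lt_or_ge i n with hi | hi
    · have e := hF i hi 1 (by omega)
      rw [show p + 1 - 1 = p by omega] at e
      rw [hB i hi.le, hB (i + 1) hi, e]
      rcases i with _ | i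
      · rw [gridExt_eq_zero f (i := 0) (j := 1) (by omega), zero_add, cheb_one, cheb_zero]
        push_cast
        linear_combination hmu
      · rw [hB i (by omega), cheb_add_two]
        push_cast
        linear_combination (cheb μ (i + 1) : ℂ) * hmu
    · rw [gridExt_eq_zero f (i := i + 1) (j := 2) (by omega), add_zero]
      obtain ⟨m, rfl⟩ : ∃ m, i = n + m := ⟨i - n, by omega⟩
      have e1 := hT m
      have e2 := hT (m + 1)
      rw [show n + 1 + m = n + m + 1 by omega] at e1
      rw [show n + 1 + (m + 1) = n + m + 2 by omega] at e2
      rw [e1, e2]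
      -- Only the first tail vertex, whose left neighbour is on the backbone, needs the secular
      -- equation.
      rcases m with _ | m
      · have e3 := hB (n - 1) (by omega)
        rw [show n - 1 + 1 = n by omega] at e3
        rw [add_zero, e3, hs']
        linear_combination (cheb μ (n - 1) * cheb x (p + 1) : ℂ) * hsq
      · have e3 := hT m
        rw [show n + 1 + m = n + (m + 1) by omega] at e3
        rw [e3]
        linear_combination (cheb μ n * cheb x (p + 1) * (ξ : ℂ) ^ m) * hsq

theorem hasEigenvalue_iff_secular {n k : ℕ} (hn : 2 ≤ n) (hk : 2 ≤ k) {x : ℝ} (hx : 2 < x) :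
    Module.End.HasEigenvalue (combTailOp n k hn hk :
      ell2 ((Fin n × Fin k) ⊕ ℕ) →ₗ[ℂ] ell2 ((Fin n × Fin k) ⊕ ℕ)) x ↔ Secular n k x := by
  constructor
  · intro h
    obtain ⟨f, hf, hf0⟩ := h.exists_hasEigenvector
    exact secular_of_eigenvector hn hk hx (Module.End.mem_eigenspace_iff.1 hf) hf0
  · intro h
    obtain ⟨f, hf0, hf⟩ := exists_eigenvector_of_secular hn hk hx h
    exact Module.End.hasEigenvalue_of_hasEigenvector (x := f)
      ⟨Module.End.mem_eigenspace_iff.2 hf, hf0⟩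

theorem exists_injective_eigenspace {n k : ℕ} (hn : 2 ≤ n) (hk : 2 ≤ k) {x : ℝ} (hx : 2 < x) :
    ∃ L : Module.End.eigenspace (combTailOp n k hn hk :
      ell2 ((Fin n × Fin k) ⊕ ℕ) →ₗ[ℂ] ell2 ((Fin n × Fin k) ⊕ ℕ)) x →ₗ[ℂ] ℂ,
      Function.Injective L := by
  let L : Module.End.eigenspace (combTailOp n k hn hk :
      ell2 ((Fin n × Fin k) ⊕ ℕ) →ₗ[ℂ] ell2 ((Fin n × Fin k) ⊕ ℕ)) x →ₗ[ℂ] ℂ :=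
    { toFun := fun f => (f : ell2 ((Fin n × Fin k) ⊕ ℕ))
        (Sum.inl (⟨0, by omega⟩, ⟨0, by omega⟩))
      map_add' := fun f g => by simp
      map_smul' := fun c f => by simp }
  refine ⟨L, (injective_iff_map_eq_zero L).2 fun f hf => Subtype.ext ?_⟩
  refine eigenvector_eq_zero hn hk hx (Module.End.mem_eigenspace_iff.1 f.2) ?_
  rw [← hf]
  exact gridExt_inl _ _ _

section

open Set

/-! ### The spectrum of the comb graph with tail -/

/-- The sign of a vertex in the bipartition of the comb graph with tail. -/
def vertexSign (n k : ℕ) (v : (Fin n × Fin k) ⊕ ℕ) : ℂ :=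
  (-1) ^ ((gridPos n k v).1 + (gridPos n k v).2)

theorem norm_vertexSign (n k : ℕ) (v : (Fin n × Fin k) ⊕ ℕ) : ‖vertexSign n k v‖ = 1 := by
  simp [vertexSign]

theorem vertexSign_of_adj {n k : ℕ} (hn : 2 ≤ n) (hk : 2 ≤ k) (v w : (Fin n × Fin k) ⊕ ℕ)
    (h : (combTail n k hn hk).Adj v w) : vertexSign n k w = -vertexSign n k v := by
  rw [adj_iff_gridPos] at h
  unfold vertexSign
  have : (gridPos n k w).1 + (gridPos n k w).2 = (gridPos n k v).1 + (gridPos n k v).2 + 1 ∨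
      (gridPos n k v).1 + (gridPos n k v).2 = (gridPos n k w).1 + (gridPos n k w).2 + 1 := by
    omega
  rcases this with h | h
  · rw [h, pow_succ]
    ring
  · rw [h, pow_succ]
    ring

theorem exists_injective_eigenspace_combTailOp_neg {n k : ℕ} (hn : 2 ≤ n) (hk : 2 ≤ k) (z : ℂ) :
    ∃ L : Module.End.eigenspace (combTailOp n k hn hk :
        ell2 ((Fin n × Fin k) ⊕ ℕ) →ₗ[ℂ] ell2 ((Fin n × Fin k) ⊕ ℕ)) z →ₗ[ℂ]
      Module.End.eigenspace (combTailOp n k hn hk :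
        ell2 ((Fin n × Fin k) ⊕ ℕ) →ₗ[ℂ] ell2 ((Fin n × Fin k) ⊕ ℕ)) (-z),
      Function.Injective L :=
  exists_injective_eigenspace_neg _ _ _ (norm_vertexSign n k) (vertexSign_of_adj hn hk) z

theorem hasEigenvalue_neg {n k : ℕ} (hn : 2 ≤ n) (hk : 2 ≤ k) {z : ℂ}
    (h : Module.End.HasEigenvalue (combTailOp n k hn hk :
      ell2 ((Fin n × Fin k) ⊕ ℕ) →ₗ[ℂ] ell2 ((Fin n × Fin k) ⊕ ℕ)) z) :
    Module.End.HasEigenvalue (combTailOp n k hn hk :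
      ell2 ((Fin n × Fin k) ⊕ ℕ) →ₗ[ℂ] ell2 ((Fin n × Fin k) ⊕ ℕ)) (-z) := by
  obtain ⟨f, hf, hf0⟩ := h.exists_hasEigenvector
  obtain ⟨L, hL⟩ := exists_injective_eigenspace_combTailOp_neg hn hk z
  refine Module.End.hasEigenvalue_of_hasEigenvector (x := (L ⟨f, hf⟩ : ell2 _))
    ⟨(L ⟨f, hf⟩).2, fun h0 => hf0 ?_⟩
  have : L ⟨f, hf⟩ = 0 := Subtype.ext h0
  exact congrArg Subtype.val ((map_eq_zero_iff L hL).1 this)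

/-- The eigenvalues of modulus above `2` are simple. -/
theorem exists_injective_eigenspace_of_two_lt_abs {n k : ℕ} (hn : 2 ≤ n) (hk : 2 ≤ k) {x : ℝ}
    (hx : 2 < |x|) :
    ∃ L : Module.End.eigenspace (combTailOp n k hn hk :
      ell2 ((Fin n × Fin k) ⊕ ℕ) →ₗ[ℂ] ell2 ((Fin n × Fin k) ⊕ ℕ)) x →ₗ[ℂ] ℂ,
      Function.Injective L := by
  rcases lt_abs.1 hx with hx | hx
  · exact exists_injective_eigenspace hn hk hx
  · have hL := exists_injective_eigenspace hn hk hx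
    rw [Complex.ofReal_neg] at hL
    obtain ⟨L, hL⟩ := hL
    obtain ⟨M, hM⟩ := exists_injective_eigenspace_combTailOp_neg hn hk (x : ℂ)
    exact ⟨L ∘ₗ M, hL.comp hM⟩

/-- For `x = ζ + ζ⁻¹` with `|ζ| = 1`, the wave `ζ^m` cut off after `N` tail vertices has norm at
least `√N`, but `x - A` leaves only four boundary terms of modulus one. -/
theorem Icc_subset_spectrum {n k : ℕ} (hn : 2 ≤ n) (hk : 2 ≤ k) :
    Complex.ofReal '' Icc (-2) 2 ⊆ spectrum ℂ (combTailOp n k hn hk) := by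
  classical
  rintro _ ⟨x, hx, rfl⟩
  obtain ⟨ζ, hζ, hx'⟩ : ∃ ζ : ℂ, ‖ζ‖ = 1 ∧ ζ ^ 2 + 1 = x * ζ := by
    have hc : 2 * Real.cos (Real.arccos (x / 2)) = x := by
      rw [Real.cos_arccos (by linarith [hx.1]) (by linarith [hx.2])]
      ring
    refine ⟨Complex.exp (Real.arccos (x / 2) * Complex.I), Complex.norm_exp_ofReal_mul_I _, ?_⟩
    have hs : (Real.sin (Real.arccos (x / 2)) : ℂ) ^ 2 + (Real.cos (Real.arccos (x / 2)) : ℂ) ^ 2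
        = 1 := by
      exact_mod_cast Real.sin_sq_add_cos_sq _
    have hcx : (x : ℂ) = 2 * (Real.cos (Real.arccos (x / 2)) : ℂ) := by exact_mod_cast hc.symm
    rw [Complex.exp_mul_I, ← Complex.ofReal_cos, ← Complex.ofReal_sin]
    linear_combination (Real.sin (Real.arccos (x / 2)) : ℂ) ^ 2 * Complex.I_sq - hs -
      (Real.cos (Real.arccos (x / 2)) + Real.sin (Real.arccos (x / 2)) * Complex.I) * hcx
  refine mem_spectrum_of_unbounded 4 fun R => ?_
  obtain ⟨N, hN⟩ := exists_nat_gt (R ^ 2)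
  let δ : ℕ → ell2 ((Fin n × Fin k) ⊕ ℕ) := fun m => lp.single 2 (Sum.inr m) (1 : ℂ)
  have hδ : ∀ m, ‖δ m‖ = 1 := fun m => by simp [δ, lp.norm_single]
  have hAδ : ∀ m, combTailOp n k hn hk (δ (m + 1)) = δ m + δ (m + 2) := by
    intro m
    have : nbrs (uniformlyLocallyFinite_combTail n k hn hk) (Sum.inr (m + 1))
        = {Sum.inr m, Sum.inr (m + 2)} := by
      ext w
      rw [mem_nbrs, adj_iff_gridPos]
      rcases w with ⟨⟨i, hi⟩, ⟨j, hj⟩⟩ | w <;> simp [gridPos] <;> omega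
    rw [combTailOp, adjOp_single, this, Finset.sum_pair (by simp)]
  let g : ℕ → ell2 ((Fin n × Fin k) ⊕ ℕ) := fun N => ∑ m ∈ Finset.range N, ζ ^ m • δ (m + 1)
  -- The factor `ζ`, of modulus one, avoids the inverse power `ζ⁻¹`.
  have hg : ∀ N, ζ • ((x : ℂ) • g N - combTailOp n k hn hk (g N))
      = -(ζ • δ 0) + δ 1 + ζ ^ (N + 1) • δ N - ζ ^ N • δ (N + 1) := by
    intro N
    induction N with
    | zero => simp [g]
    | succ N ih =>
      have hsucc : g (N + 1) = g N + ζ ^ N • δ (N + 1) := Finset.sum_range_succ _ _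
      have hstep : ζ • ((x : ℂ) • ζ ^ N • δ (N + 1) - ζ ^ N • (δ N + δ (N + 2)))
          = (ζ ^ N * (ζ ^ 2 + 1)) • δ (N + 1) - ζ ^ (N + 1) • δ N - ζ ^ (N + 1) • δ (N + 2) := by
        rw [hx']
        module
      rw [hsucc, map_add, map_smul, hAδ, smul_add (x : ℂ), add_sub_add_comm, smul_add ζ, ih, hstep]
      module
  refine ⟨g N, ?_, ?_⟩
  · have hval : ∀ m < N, g N (Sum.inr (m + 1)) = ζ ^ m := by
      intro m hm
      simp only [g, δ, lp.coeFn_sum, Finset.sum_apply, lp.coeFn_smul, Pi.smul_apply,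
        lp.coeFn_single, Pi.single_apply, Sum.inr.injEq, add_left_inj, smul_eq_mul]
      simp [hm]
    have h1 := lp.sum_rpow_le_norm_rpow (p := 2) (by simp) (g N)
      ((Finset.range N).map ⟨fun m => Sum.inr (m + 1), fun a b h => by simpa using h⟩)
    rw [Finset.sum_map] at h1
    change ∑ m ∈ Finset.range N, ‖g N (Sum.inr (m + 1))‖ ^ (2 : ℝ≥0∞).toReal ≤ _ at h1
    have h2 : ∑ m ∈ Finset.range N, ‖g N (Sum.inr (m + 1))‖ ^ (2 : ℝ≥0∞).toReal = N := by
      rw [Finset.sum_congr rfl fun m hm => by rw [hval m (Finset.mem_range.1 hm)]]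
      simp [hζ]
    have h3 : (N : ℝ) ≤ ‖g N‖ ^ 2 := by
      rw [h2] at h1
      simpa using h1
    exact lt_of_pow_lt_pow_left₀ 2 (norm_nonneg _) (hN.trans_le h3)
  · have h1 : ‖(x : ℂ) • g N - combTailOp n k hn hk (g N)‖
        = ‖ζ • ((x : ℂ) • g N - combTailOp n k hn hk (g N))‖ := by rw [norm_smul, hζ, one_mul]
    rw [h1, hg]
    refine (norm_sub_le _ _).trans ?_
    refine (add_le_add_left (norm_add₃_le ..) _).trans ?_
    simp only [norm_neg, norm_smul, norm_pow, hζ, hδ, one_pow, mul_one]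
    norm_num

/-- The eigenvalues of modulus above `2`. -/
def outerEigenvalues (n k : ℕ) (hn : 2 ≤ n) (hk : 2 ≤ k) : Set ℂ :=
  {z | ∃ x : ℝ, (x : ℂ) = z ∧ 2 < |x| ∧ Module.End.HasEigenvalue (combTailOp n k hn hk :
    ell2 ((Fin n × Fin k) ⊕ ℕ) →ₗ[ℂ] ell2 ((Fin n × Fin k) ⊕ ℕ)) z}

theorem spectrum_combTailOp {n k : ℕ} (hn : 2 ≤ n) (hk : 2 ≤ k) :
    spectrum ℂ (combTailOp n k hn hk) =
      Complex.ofReal '' Icc (-2) 2 ∪ outerEigenvalues n k hn hk := by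
  refine Subset.antisymm (fun z hz => ?_) (union_subset (Icc_subset_spectrum hn hk) ?_)
  · by_cases h : z ∈ Complex.ofReal '' Icc (-2) 2
    · exact Or.inl h
    · refine Or.inr ⟨z.re, ?_, ?_, hasEigenvalue_of_mem_spectrum_coupling _ _ _ hz h⟩
      · exact ((isSelfAdjoint_adjOp _ _).mem_spectrum_eq_re hz).symm
      · by_contra! h'
        exact h ⟨z.re, abs_le.1 h', ((isSelfAdjoint_adjOp _ _).mem_spectrum_eq_re hz).symm⟩
  · rintro z ⟨-, -, -, hz⟩
    exact mem_spectrum_of_hasEigenvalue hz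

theorem finite_outerEigenvalues {n k : ℕ} (hn : 2 ≤ n) (hk : 2 ≤ k) :
    (outerEigenvalues n k hn hk).Finite := by
  have hfin := (finite_secular (n := n) (by omega) hk).image (fun x : ℝ => (x : ℂ))
  refine (hfin.union (hfin.image Neg.neg)).subset ?_
  rintro _ ⟨x, rfl, hx, h⟩
  rcases lt_abs.1 hx with hx | hx
  · exact Or.inl ⟨x, ⟨hx, (hasEigenvalue_iff_secular hn hk hx).1 h⟩, rfl⟩
  · have h' := hasEigenvalue_neg hn hk h
    rw [← Complex.ofReal_neg] at h'
    refine Or.inr ⟨((-x : ℝ) : ℂ), ⟨-x, ⟨hx, (hasEigenvalue_iff_secular hn hk hx).1 h'⟩, rfl⟩, ?_⟩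
    simp

theorem disjoint_outerEigenvalues {n k : ℕ} (hn : 2 ≤ n) (hk : 2 ≤ k) :
    Disjoint (Complex.ofReal '' Icc (-2) 2) (outerEigenvalues n k hn hk) := by
  rw [Set.disjoint_left]
  rintro _ ⟨x, hx, rfl⟩ ⟨y, hy, hy', -⟩
  rw [Complex.ofReal_inj.1 hy] at hy'
  exact absurd (abs_le.2 hx) (not_le.2 hy')

theorem exists_mem_Icc_near {x ε : ℝ} (hx : x ∈ Icc (-2 : ℝ) 2) (hε : 0 < ε) :
    ∃ y ∈ Icc (-2 : ℝ) 2, |y - x| < ε ∧ y ≠ x := by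
  have h1 : 0 < min (ε / 2) 1 := lt_min (by linarith) one_pos
  have h2 := min_le_left (ε / 2) 1
  have h3 := min_le_right (ε / 2) 1
  rcases le_total 0 x with h | h
  · refine ⟨x - min (ε / 2) 1, ⟨by linarith, by linarith [hx.2]⟩, ?_, by linarith⟩
    rw [abs_lt]
    constructor <;> linarith
  · refine ⟨x + min (ε / 2) 1, ⟨by linarith [hx.1], by linarith⟩, ?_, by linarith⟩
    rw [abs_lt]
    constructor <;> linarith

theorem finiteDimensional_eigenspace {n k : ℕ} (hn : 2 ≤ n) (hk : 2 ≤ k) {x : ℝ} (hx : 2 < |x|) :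
    FiniteDimensional ℂ (Module.End.eigenspace (combTailOp n k hn hk :
      ell2 ((Fin n × Fin k) ⊕ ℕ) →ₗ[ℂ] ell2 ((Fin n × Fin k) ⊕ ℕ)) x) := by
  obtain ⟨L, hL⟩ := exists_injective_eigenspace_of_two_lt_abs hn hk hx
  exact FiniteDimensional.of_injective L hL

theorem multiplicity_le_one {n k : ℕ} (hn : 2 ≤ n) (hk : 2 ≤ k) {x : ℝ} (hx : 2 < |x|) :
    multiplicity (combTailOp n k hn hk) x ≤ 1 := by
  obtain ⟨L, hL⟩ := exists_injective_eigenspace_of_two_lt_abs hn hk hx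
  have := LinearMap.finrank_le_finrank_of_injective hL
  rwa [Module.finrank_self] at this

/-- No point of `[-2, 2]` is isolated in the spectrum, whether or not it is an eigenvalue. The outer
eigenvalues are finitely many and off this closed interval, hence isolated. -/
theorem discreteSpectrum_combTailOp {n k : ℕ} (hn : 2 ≤ n) (hk : 2 ≤ k) :
    discreteSpectrum (combTailOp n k hn hk) = outerEigenvalues n k hn hk := by
  refine Subset.antisymm ?_ ?_
  · rintro z ⟨hz, ⟨ε, hε, hiso⟩, -, -⟩
    rw [spectrum_combTailOp] at hz
    refine hz.resolve_left ?_
    rintro ⟨x, hx, rfl⟩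
    obtain ⟨y, hy, hy1, hy2⟩ := exists_mem_Icc_near hx hε
    refine hy2 (Complex.ofReal_inj.1 (hiso y (Icc_subset_spectrum hn hk ⟨y, hy, rfl⟩) ?_))
    rwa [Complex.dist_eq, ← Complex.ofReal_sub, Complex.norm_real, Real.norm_eq_abs]
  · intro z hz
    have hclosed : IsClosed (Complex.ofReal '' Icc (-2) 2 ∪ (outerEigenvalues n k hn hk \ {z})) :=
      (isCompact_Icc.image Complex.continuous_ofReal).isClosed.union
        ((finite_outerEigenvalues hn hk).subset sdiff_subset).isClosed
    have hzc : z ∈ (Complex.ofReal '' Icc (-2) 2 ∪ (outerEigenvalues n k hn hk \ {z}))ᶜ := by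
      rintro (h | h)
      · exact Set.disjoint_left.1 (disjoint_outerEigenvalues hn hk) h hz
      · exact h.2 rfl
    obtain ⟨ε, hε, hball⟩ := Metric.isOpen_iff.1 hclosed.isOpen_compl z hzc
    have hmem : z ∈ spectrum ℂ (combTailOp n k hn hk) := by
      rw [spectrum_combTailOp]
      exact Or.inr hz
    refine ⟨hmem, ⟨ε, hε, fun w hw hwz => ?_⟩, ?_⟩
    · by_contra hne
      rw [spectrum_combTailOp] at hw
      exact hball hwz (hw.imp id fun h => ⟨h, hne⟩)
    · obtain ⟨x, rfl, hx, h⟩ := hz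
      exact ⟨h, finiteDimensional_eigenspace hn hk hx⟩

/-! ### The points above `2` and the smallest intervals -/

theorem posDiscreteSpectrum_eq {n k : ℕ} (hn : 2 ≤ n) (hk : 2 ≤ k) :
    posDiscreteSpectrum n k hn hk = {x | 2 < x ∧ Secular n k x} := by
  ext x
  change 2 < x ∧ (x : ℂ) ∈ discreteSpectrum (combTailOp n k hn hk) ↔ 2 < x ∧ Secular n k x
  refine and_congr_right fun hx => ?_
  rw [discreteSpectrum_combTailOp, ← hasEigenvalue_iff_secular hn hk hx]
  constructor
  · rintro ⟨-, -, -, h⟩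
    exact h
  · exact fun h => ⟨x, rfl, lt_abs.2 (Or.inl hx), h⟩

theorem neg_mem_outerEigenvalues {n k : ℕ} (hn : 2 ≤ n) (hk : 2 ≤ k) {z : ℂ}
    (hz : z ∈ outerEigenvalues n k hn hk) : -z ∈ outerEigenvalues n k hn hk := by
  obtain ⟨x, rfl, hx, h⟩ := hz
  exact ⟨-x, by simp, by rwa [abs_neg], hasEigenvalue_neg hn hk h⟩

theorem posDiscreteSpectrum_subset_oscRegion {n k : ℕ} (hn : 2 ≤ n) (hk : 2 ≤ k) :
    posDiscreteSpectrum n k hn hk ⊆ oscRegion k := by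
  rw [posDiscreteSpectrum_eq]
  exact fun x hx => mem_oscRegion_of_secular (by omega) hx.1.le hx.2

/-- A closed interval that contains the eigenvalues above `2` for all `n` contains the
oscillation region. -/
theorem oscRegion_subset_Icc {k : ℕ} (hk : 2 ≤ k) {a b : ℝ}
    (h : ∀ (n : ℕ) (hn : 2 ≤ n), posDiscreteSpectrum n k hn hk ⊆ Icc a b) :
    oscRegion k ⊆ Icc a b := by
  have hpair : ∀ x ∈ oscRegion k, ∀ y ∈ oscRegion k, x < y → ∃ z ∈ Ioo x y, z ∈ Icc a b := by
    intro x hx y hy hxy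
    obtain ⟨n, hn, z, hz, hs⟩ := exists_secular_mem_Ioo hx hy hxy
    refine ⟨z, hz, h n hn ?_⟩
    rw [posDiscreteSpectrum_eq]
    exact ⟨hx.1.trans_lt hz.1, hs⟩
  obtain ⟨c, hc, hc', hsub⟩ := exists_oscRegion_sup hk
  have hlt : ∀ x ∈ oscRegion k, x < c := by
    intro x hx
    by_contra! hcx
    have := (strictMonoOn_chebRatio (k - 1)).monotoneOn hc.le hx.1 hcx
    linarith [hx.2]
  intro x hx
  rw [← closure_Icc]
  refine Metric.mem_closure_iff.2 fun ε hε => ?_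
  have hxc := hlt x hx
  -- The minimum keeps the second point both inside the region and within `ε` of `x`.
  have hm : x < min c (x + ε) := lt_min hxc (by linarith)
  obtain ⟨z, hz, hz'⟩ := hpair x hx ((x + min c (x + ε)) / 2)
    (hsub ⟨by linarith [hx.1], by linarith [min_le_left c (x + ε)]⟩) (by linarith)
  refine ⟨z, hz', ?_⟩
  rw [Real.dist_eq, abs_lt]
  have := min_le_right c (x + ε)
  constructor <;> linarith [hz.1, hz.2]

theorem Icc_subset_Icc_of_Ico_subset {a b c d : ℝ} (hcd : c < d) (h : Ico c d ⊆ Icc a b) :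
    Icc c d ⊆ Icc a b := by
  rw [← closure_Ico hcd.ne]
  exact closure_minimal h isClosed_Icc

end

end CombTail

end

/-! ### Assembly of the four claims -/

theorem theorem1 :
    (∀ (n k : ℕ) (hn : 2 ≤ n) (hk : 2 ≤ k),
      -- (i) the spectrum
      (spectrum ℂ (CombTail.combTailOp n k hn hk) =
          Complex.ofReal '' Set.Icc (-2) 2 ∪
            CombTail.discreteSpectrum (CombTail.combTailOp n k hn hk) ∧
        Disjoint (Complex.ofReal '' Set.Icc (-2) 2)
          (CombTail.discreteSpectrum (CombTail.combTailOp n k hn hk)) ∧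
        (CombTail.discreteSpectrum (CombTail.combTailOp n k hn hk)).Finite ∧
        (∀ z : ℂ, z ∈ CombTail.discreteSpectrum (CombTail.combTailOp n k hn hk) ↔
          -z ∈ CombTail.discreteSpectrum (CombTail.combTailOp n k hn hk))) ∧
      -- (ii) the number of eigenvalues above 2; the quotient `a_{n,k}` is well defined
      (Real.sin (((n : ℝ) + 1) * CombTail.omega k) ≠ 0 ∧
        ((CombTail.posDiscreteSpectrum n k hn hk).ncard : ℤ) =
          ⌊CombTail.omega k / Real.pi * ((n : ℝ) + 1)⌋ +
            CombTail.heaviside (CombTail.aCoef n k - 1)) ∧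
      -- (iv) the multiplicities
      ((∀ z ∈ CombTail.discreteSpectrum (CombTail.combTailOp n k hn hk),
          CombTail.multiplicity (CombTail.combTailOp n k hn hk) z ≤ 2) ∧
        {z ∈ CombTail.discreteSpectrum (CombTail.combTailOp n k hn hk) |
          CombTail.multiplicity (CombTail.combTailOp n k hn hk) z = 2}.encard ≤ 4)) ∧
    -- (iii) the location of the eigenvalues above 2, for all `n, k`, and for `k = 2`
    ((∀ (n k : ℕ) (hn : 2 ≤ n) (hk : 2 ≤ k),
        CombTail.posDiscreteSpectrum n k hn hk ⊆ Set.Icc 2 (5 / 2)) ∧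
      (∀ a b : ℝ,
        (∀ (n k : ℕ) (hn : 2 ≤ n) (hk : 2 ≤ k),
          CombTail.posDiscreteSpectrum n k hn hk ⊆ Set.Icc a b) →
        Set.Icc (2 : ℝ) (5 / 2) ⊆ Set.Icc a b)) ∧
    ((∀ (n : ℕ) (hn : 2 ≤ n),
        CombTail.posDiscreteSpectrum n 2 hn le_rfl ⊆ Set.Icc 2 (1 + √2)) ∧
      (∀ a b : ℝ,
        (∀ (n : ℕ) (hn : 2 ≤ n),
          CombTail.posDiscreteSpectrum n 2 hn le_rfl ⊆ Set.Icc a b) →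
        Set.Icc (2 : ℝ) (1 + √2) ⊆ Set.Icc a b)) := by
  refine ⟨fun n k hn hk => ⟨⟨?_, ?_, ?_, fun z => ?_⟩,
    ⟨CombTail.sin_mul_omega_ne_zero n hk, ?_⟩, fun z hz => ?_, ?_⟩, ⟨?_, fun a b h => ?_⟩,
    ?_, fun a b h => ?_⟩
  · rw [CombTail.discreteSpectrum_combTailOp, CombTail.spectrum_combTailOp]
  · rw [CombTail.discreteSpectrum_combTailOp]
    exact CombTail.disjoint_outerEigenvalues hn hk
  · rw [CombTail.discreteSpectrum_combTailOp]
    exact CombTail.finite_outerEigenvalues hn hk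
  · rw [CombTail.discreteSpectrum_combTailOp]
    refine ⟨CombTail.neg_mem_outerEigenvalues hn hk, fun h => ?_⟩
    simpa using CombTail.neg_mem_outerEigenvalues hn hk h
  · rw [CombTail.posDiscreteSpectrum_eq]
    exact CombTail.ncard_secular (by omega) hk
  · rw [CombTail.discreteSpectrum_combTailOp] at hz
    obtain ⟨x, rfl, hx, -⟩ := hz
    exact (CombTail.multiplicity_le_one hn hk hx).trans one_le_two
  -- All points of the discrete spectrum are simple, so the set of double points is empty.
  · refine le_trans (le_of_eq ?_) (by norm_num : (0 : ℕ∞) ≤ 4)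
    rw [Set.encard_eq_zero, Set.eq_empty_iff_forall_notMem]
    rintro z ⟨hz, hz'⟩
    rw [CombTail.discreteSpectrum_combTailOp] at hz
    obtain ⟨x, rfl, hx, -⟩ := hz
    have := CombTail.multiplicity_le_one hn hk hx
    omega
  · intro n k hn hk x hx
    have := CombTail.posDiscreteSpectrum_subset_oscRegion hn hk hx
    exact ⟨this.1, (CombTail.lt_of_mem_oscRegion this).le⟩
  -- The right end point is only a limit of eigenvalues, so it is recovered by closedness.
  · refine CombTail.Icc_subset_Icc_of_Ico_subset (by norm_num) fun x hx => ?_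
    obtain ⟨k, hk, hxk⟩ := CombTail.exists_mem_oscRegion hx.1 hx.2
    exact CombTail.oscRegion_subset_Icc hk (fun n hn => h n k hn hk) hxk
  · intro n hn x hx
    have := CombTail.posDiscreteSpectrum_subset_oscRegion hn le_rfl hx
    exact ⟨this.1, (CombTail.lt_of_mem_oscRegion_two this).le⟩
  · have h1 : 1 < √2 := by
      rw [Real.lt_sqrt zero_le_one]
      norm_num
    refine CombTail.Icc_subset_Icc_of_Ico_subset (by linarith) fun x hx => ?_
    exact CombTail.oscRegion_subset_Icc le_rfl h (CombTail.mem_oscRegion_two hx.1 hx.2)
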